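/- Let $n\ge 2$, let $\Pi=\{x+iy: y>0\}$ be the upper half-plane with area measure, and let $\mathcal{A}^2(\Pi)\subset L_2(\Pi)$ be the Bergman space of square-integrable holomorphic functions, with orthogonal projection $B:L_2(\Pi)\to\mathcal{A}^2(\Pi)$. Put $a_k(z)=\chi_{[k-1,k)}(\operatorname{Im} z)$ for $1\le k\le n-1$ and $a_n(z)=\chi_{[n-1,\infty)}(\operatorname{Im} z)$, and let $T_{a_k}f=B(a_kf)$ be the corresponding Toeplitz operators on $\mathcal{A}^2(\Pi)$. On the Hilbert direct sum $(\mathcal{A}^2(\Pi))^n$ consider $$P_T=\Big(\sqrt{T_{a_j}}\sqrt{T_{a_k}}\Big)_{j,k=1}^n,\qquad Q_{\Pi,(j)}(f_1,\dots,f_n)=(0,\dots,f_j,\dots,0),\quad j=1,\dots,n .$$ Let $R_1:L_2(\Pi)\to L_2(\mathbb{R}_+)$ be the adjoint of the isometry $$(R_1^*f)(x+iy)=\frac1{\sqrt{2\pi}}\int_0^\infty e^{ixt}\sqrt{2t}\,\ell_0(2ty)f(t)\,dt,\qquad \ell_0(y)=e^{-y/2},$$ and let $\mathbf{R}=R_1\oplus\cdots\oplus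 R_1:(\mathcal{A}^2(\Pi))^n\to (L_2(\mathbb{R}_+))^n$, where $R_1$ is restricted to $\mathcal{A}^2(\Pi)$. Let $\gamma^{a_j}$ be the continuous extension to $[0,\infty]$ of $\gamma^{a_j}(x)=\int_0^\infty a_j\big(\tfrac{y}{2x}\big)\ell_0(y)^2dy$, $0<x<\infty$ (where $a_j$ is regarded as a function of $\operatorname{Im} z$), let $P_\gamma=\big(\sqrt{\gamma^{a_j}}\sqrt{\gamma^{a_k}}\big)_{j,k=1}^n$, and let $Q_j$ be the constant matrix unit $E_{jj}$. Let $\mathcal{D}_n^{1,n}$ be the $C^*$-algebra of all continuous $M:[0,\infty]\to M_n(\mathbb{C})$ such that $M(0)$ and $M(\infty)$ are diagonal and $M_{jj}(0)=M_{jj}(\infty)$ for $j=2,\dots,n-1$, with the supremum of the operator norms. A matrix function $M\in\mathcal{D}_n^{1,n}$ is identified with the operator of multiplication by $M$ on $(L_2(\mathbb{R}_+))^n$. Then: 1. $\mathcal{D}_n^{1,n}$ is the $C^*$-algebra generated by $P_\gamma,Q_1,\dots,Q_n$ (in $M_n(\mathbb{C})\otimes C[0,\infty]$). 2. For every $S$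 in the $C^*$-algebra $\mathcal{C}^*(P_T;\{Q_{\Pi,(j)}\}_{j=1}^n)$ generated by $P_T,Q_{\Pi,(1)},\dots,Q_{\Pi,(n)}$, the operator $\mathbf{R}S\mathbf{R}^*$ is multiplication by an element of $\mathcal{D}_n^{1,n}$, and $S\mapsto \mathbf{R}S\mathbf{R}^*$ is an isometric $*$-isomorphism of $\mathcal{C}^*(P_T;\{Q_{\Pi,(j)}\}_{j=1}^n)$ onto $\mathcal{D}_n^{1,n}$, under which $P_T\mapsto P_\gamma$ and $Q_{\Pi,(j)}\mapsto Q_j$ for $j=1,\dots,n$. -/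

import Mathlib

open MeasureTheory Complex Set Filter Topology
open scoped ENNReal FourierTransform Matrix.Norms.L2Operator

noncomputable section

namespace PolyBergman

/-! ### The Bergman space of the upper half-plane -/

/-- The upper half-plane `Π`. -/
abbrev upperHalf : Set ℂ := {z | 0 < z.im}

/-- `L₂(Π)`, with respect to the area measure. -/
abbrev L2Plane : Type := Lp ℂ 2 (volume.restrict upperHalf)

/-- `L₂(ℝ₊)`, with respect to Lebesgue measure. -/
abbrev L2Pos : Type := Lp ℂ 2 (volume.restrict (Ioi (0 : ℝ)))

/-- The classes in `L₂(Π)` that have a representative holomorphic on `Π`. -/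
def bergman : Submodule ℂ L2Plane where
  carrier := {f | ∃ g : ℂ → ℂ, DifferentiableOn ℂ g upperHalf ∧ f =ᵐ[volume.restrict upperHalf] g}
  zero_mem' := ⟨0, differentiableOn_const 0, Lp.coeFn_zero ..⟩
  add_mem' := by
    rintro f₁ f₂ ⟨g₁, h₁, e₁⟩ ⟨g₂, h₂, e₂⟩
    exact ⟨g₁ + g₂, h₁.add h₂, (Lp.coeFn_add f₁ f₂).trans (e₁.add e₂)⟩
  smul_mem' := by
    rintro c f ⟨g, h, e⟩
    exact ⟨c • g, h.const_smul c, (Lp.coeFn_smul c f).trans (e.const_smul c)⟩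

theorem isOpen_upperHalf : IsOpen upperHalf := isOpen_lt continuous_const Complex.continuous_im

/-- Mean value inequality for holomorphic functions. -/
theorem enorm_mul_area_le {g : ℂ → ℂ} {c : ℂ} {R : ℝ} (hR : 0 < R)
    (hg : DifferentiableOn ℂ g (Metric.ball c R)) :
    ‖g c‖ₑ * ENNReal.ofReal (Real.pi * R ^ 2) ≤ ∫⁻ z in Metric.ball c R, ‖g z‖ₑ := by
  have mv : ∀ r ∈ Ioo 0 R, ENNReal.ofReal (2 * Real.pi) * ‖g c‖ₑ ≤
      ∫⁻ θ in Ioo (-Real.pi) Real.pi, ‖g (circleMap c r θ)‖ₑ := by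
    intro r hr
    have h1 : DiffContOnCl ℂ g (Metric.ball c |r|) := by
      rw [abs_of_pos hr.1]
      refine DifferentiableOn.diffContOnCl (hg.mono ?_)
      rw [closure_ball _ hr.1.ne']
      exact Metric.closedBall_subset_ball hr.2
    have h2 := h1.circleAverage
    have h3 : g c = (2 * Real.pi)⁻¹ • ∫ θ in (-Real.pi)..Real.pi, g (circleMap c r θ) := by
      rw [← h2, Real.circleAverage_def]
      congr 1
      have := (periodic_circleMap c r).comp g
      have e := this.intervalIntegral_add_eq 0 (-Real.pi)
      simp only [zero_add, Function.comp_def] at e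
      rw [e]; congr 1; ring
    have h4 : ‖g c‖ₑ ≤ ENNReal.ofReal ((2 * Real.pi)⁻¹) *
        ∫⁻ θ in Ioo (-Real.pi) Real.pi, ‖g (circleMap c r θ)‖ₑ := by
      conv_lhs => rw [h3]
      rw [enorm_smul, Real.enorm_of_nonneg (by positivity),
        intervalIntegral.integral_of_le (by linarith [Real.pi_pos]), integral_Ioc_eq_integral_Ioo]
      gcongr
      exact enorm_integral_le_lintegral_enorm _
    calc _ ≤ ENNReal.ofReal (2 * Real.pi) * (ENNReal.ofReal ((2 * Real.pi)⁻¹) *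
        ∫⁻ θ in Ioo (-Real.pi) Real.pi, ‖g (circleMap c r θ)‖ₑ) := by gcongr
      _ = _ := by
        rw [← mul_assoc, ← ENNReal.ofReal_mul (by positivity),
          mul_inv_cancel₀ (by positivity), ENNReal.ofReal_one, one_mul]
  have e1 : ∫⁻ z in Metric.ball c R, ‖g z‖ₑ =
      ∫⁻ z, (Metric.ball c R).indicator (fun z => ‖g z‖ₑ) (c + z) := by
    rw [lintegral_add_left_eq_self (μ := volume)
      (fun z => (Metric.ball c R).indicator (fun z => ‖g z‖ₑ) z) c,
      lintegral_indicator Metric.isOpen_ball.measurableSet]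
  rw [e1, ← Complex.lintegral_comp_polarCoord_symm]
  set F : ℂ → ℝ≥0∞ := (Metric.ball c R).indicator (fun z => ‖g z‖ₑ) with hF
  have hFm : Measurable F := by
    classical
    have := ContinuousOn.measurable_piecewise (s := Metric.ball c R) (f := fun z => ‖g z‖ₑ)
      (g := fun _ => 0) hg.continuousOn.enorm continuousOn_const Metric.isOpen_ball.measurableSet
    rwa [hF, ← Set.piecewise_eq_indicator]
  have hsymm : ∀ p : ℝ × ℝ, c + Complex.polarCoord.symm p = circleMap c p.1 p.2 := by
    intro p
    rw [Complex.polarCoord_symm_apply, circleMap, Complex.exp_mul_I]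
    push_cast; rfl
  simp only [hsymm, smul_eq_mul]
  have hsub : Ioo 0 R ×ˢ Ioo (-Real.pi) Real.pi ⊆ Complex.polarCoord.target := by
    rw [Complex.polarCoord_target]
    exact Set.prod_mono Ioo_subset_Ioi_self subset_rfl
  refine le_trans ?_ (lintegral_mono_set hsub)
  rw [Measure.volume_eq_prod, ← Measure.prod_restrict, lintegral_prod _ (by
    apply Measurable.aemeasurable
    apply Measurable.mul (by fun_prop)
    apply hFm.comp
    unfold circleMap
    fun_prop)]
  have hint : ∫⁻ r in Ioo 0 R, ENNReal.ofReal r = ENNReal.ofReal (R ^ 2 / 2) := by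
    rw [← ofReal_integral_eq_lintegral_ofReal]
    · rw [← integral_Ioc_eq_integral_Ioo, ← intervalIntegral.integral_of_le hR.le]
      simp
    · exact (continuous_id.integrableOn_Icc (a := 0) (b := R)).mono_set Ioo_subset_Icc_self
    · filter_upwards [ae_restrict_mem measurableSet_Ioo] with r hr using hr.1.le
  calc ‖g c‖ₑ * ENNReal.ofReal (Real.pi * R ^ 2)
      = ∫⁻ r in Ioo 0 R, ENNReal.ofReal r * (ENNReal.ofReal (2 * Real.pi) * ‖g c‖ₑ) := by
        rw [lintegral_mul_const _ (by fun_prop), hint, ← mul_assoc,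
          ← ENNReal.ofReal_mul (by positivity), mul_comm]
        congr 2; ring
    _ ≤ _ := by
        refine setLIntegral_mono' measurableSet_Ioo fun r hr => ?_
        rw [lintegral_const_mul' _ _ ENNReal.ofReal_ne_top]
        gcongr
        refine (mv r hr).trans (lintegral_mono fun θ => ?_)
        rw [hF, Set.indicator_of_mem]
        simp [circleMap, abs_of_pos hr.1, hr.2]

theorem enorm_sq_mul_area_le {g : ℂ → ℂ} {c : ℂ} {R : ℝ} (hR : 0 < R)
    (hg : DifferentiableOn ℂ g (Metric.ball c R)) :
    ‖g c‖ₑ ^ 2 * ENNReal.ofReal (Real.pi * R ^ 2) ≤ ∫⁻ z in Metric.ball c R, ‖g z‖ₑ ^ 2 := by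
  simpa using enorm_mul_area_le hR (hg.pow 2)

theorem isClosed_bergman : IsClosed (bergman : Set L2Plane) := by
  refine IsSeqClosed.isClosed fun f F hf hF => ?_
  choose g hg hfg using hf
  have key : ∀ (c : ℂ) (R : ℝ), 0 < R → Metric.ball c R ⊆ upperHalf → ∀ m n,
      ‖g m c - g n c‖ * Real.sqrt (Real.pi * R ^ 2) ≤ dist (f m) (f n) := by
    intro c R hR hc m n
    have h := enorm_sq_mul_area_le hR (((hg m).sub (hg n)).mono hc)
    have h2 : ∫⁻ z in Metric.ball c R, ‖(g m - g n) z‖ₑ ^ 2 ≤ ‖f m - f n‖ₑ ^ 2 := by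
      rw [Lp.enorm_def, eLpNorm_eq_lintegral_rpow_enorm_toReal (by norm_num) (by norm_num),
        ← ENNReal.rpow_natCast, ← ENNReal.rpow_mul]
      simp only [ENNReal.toReal_ofNat, ENNReal.rpow_ofNat, Nat.cast_ofNat, one_div, ne_eq,
        OfNat.ofNat_ne_zero, not_false_eq_true, inv_mul_cancel₀, ENNReal.rpow_one]
      refine (lintegral_mono_set hc).trans (le_of_eq (lintegral_congr_ae ?_))
      filter_upwards [Lp.coeFn_sub (f m) (f n), hfg m, hfg n] with z h1 h2 h3
      rw [h1]; simp [h2, h3]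
    have h3 := h.trans h2
    rw [dist_eq_norm]
    refine Real.sqrt_sq (norm_nonneg (f m - f n)) ▸ ?_
    rw [← Real.sqrt_sq (norm_nonneg (g m c - g n c)), ← Real.sqrt_mul (by positivity)]
    apply Real.sqrt_le_sqrt
    have h4 : ENNReal.ofReal (‖g m c - g n c‖ ^ 2 * (Real.pi * R ^ 2)) ≤
        ENNReal.ofReal (‖f m - f n‖ ^ 2) := by
      rw [ENNReal.ofReal_mul (by positivity), ENNReal.ofReal_pow (norm_nonneg _),
        ENNReal.ofReal_pow (norm_nonneg _), ofReal_norm, ofReal_norm]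
      exact h3
    exact (ENNReal.ofReal_le_ofReal_iff (by positivity)).1 h4
  have hball : ∀ z ∈ upperHalf, ∀ w ∈ Metric.ball z (z.im / 2),
      Metric.ball w (z.im / 2) ⊆ upperHalf := by
    intro z hz w hw v hv
    have h1 := Complex.abs_im_le_norm (w - z)
    have h2 := Complex.abs_im_le_norm (v - w)
    rw [Metric.mem_ball, dist_eq_norm] at hw hv
    have h3 := abs_le.1 (h1.trans hw.le)
    have h4 := abs_lt.1 (h2.trans_lt hv)
    simp only [Complex.sub_im] at h3 h4
    simp only [mem_ofPred_eq]
    linarith [h3.1, h4.1]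
  have hcau : ∀ z ∈ upperHalf, UniformCauchySeqOn g atTop (Metric.ball z (z.im / 2)) := by
    intro z hz
    rw [Metric.uniformCauchySeqOn_iff]
    intro ε hε
    have hz' : 0 < z.im := hz
    have hs : 0 < Real.sqrt (Real.pi * (z.im / 2) ^ 2) := by positivity
    obtain ⟨N, hN⟩ := Metric.cauchySeq_iff.1 hF.cauchySeq _ (mul_pos hε hs)
    refine ⟨N, fun m hm n hn w hw => ?_⟩
    have := (key w (z.im / 2) (by linarith) (hball z hz w hw) m n).trans_lt (hN m hm n hn)
    rw [dist_eq_norm]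
    exact lt_of_mul_lt_mul_right this hs.le
  have hlim : ∀ z ∈ upperHalf, ∃ l, Tendsto (fun n => g n z) atTop (𝓝 l) := by
    intro z hz
    have hz' : 0 < z.im := hz
    exact cauchySeq_tendsto_of_complete
      ((hcau z hz).cauchySeq (Metric.mem_ball_self (by linarith)))
  choose! G hG using hlim
  refine ⟨G, ?_, ?_⟩
  · refine TendstoLocallyUniformlyOn.differentiableOn (F := g) (φ := atTop) ?_
      (Eventually.of_forall hg) isOpen_upperHalf
    refine tendstoLocallyUniformlyOn_of_forall_exists_nhds fun z hz => ?_
    have hz' : 0 < z.im := hz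
    refine ⟨Metric.ball z (z.im / 2), mem_nhdsWithin_of_mem_nhds (Metric.ball_mem_nhds z (by linarith)),
      (hcau z hz).tendstoUniformlyOn_of_tendsto fun w hw => hG w ?_⟩
    exact hball z hz z (Metric.mem_ball_self (by linarith)) hw
  · obtain ⟨ns, hns, hae⟩ := (tendstoInMeasure_of_tendsto_Lp hF).exists_seq_tendsto_ae
    filter_upwards [hae, ae_all_iff.2 hfg, ae_restrict_mem isOpen_upperHalf.measurableSet]
      with z h1 h2 hz
    refine tendsto_nhds_unique h1 ?_
    simp only [h2]
    exact (hG z hz).comp hns.tendsto_atTop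

/-- The Bergman space `A²(Π)`, a Hilbert space with the norm of `L₂(Π)`. -/
def BergmanSpace : Type := bergman

instance : NormedAddCommGroup BergmanSpace := inferInstanceAs (NormedAddCommGroup bergman)

instance : InnerProductSpace ℂ BergmanSpace := inferInstanceAs (InnerProductSpace ℂ bergman)

instance completeSpace_bergman : CompleteSpace bergman :=
  isClosed_bergman.completeSpace_coe

instance : CompleteSpace BergmanSpace := inferInstanceAs (CompleteSpace bergman)

/-- The inclusion `A²(Π) → L₂(Π)`. -/
def bergmanIncl : BergmanSpace →L[ℂ] L2Plane := bergman.subtypeL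

/-- The orthogonal projection `L₂(Π) → A²(Π)`. -/
def bergmanProj : L2Plane →L[ℂ] BergmanSpace := bergman.orthogonalProjectionOnto

/-! ### Toeplitz operators -/

/-- Multiplication by `a ∈ L_∞` on `L₂`. -/
def mulLp {α : Type*} [MeasurableSpace α] {μ : Measure α} (a : Lp ℂ ∞ μ) :
    Lp ℂ 2 μ →L[ℂ] Lp ℂ 2 μ :=
  (ContinuousLinearMap.mul ℂ ℂ).holderL μ ∞ 2 2 a

/-- The Toeplitz operator `T_a f = B(a f)` on the Bergman space. -/
def toeplitz (a : Lp ℂ ∞ (volume.restrict upperHalf)) : BergmanSpace →L[ℂ] BergmanSpace :=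
  bergmanProj ∘L mulLp a ∘L bergmanIncl

/-- The vertical symbols as functions of `y = Im z`. The index `j : Fin n` stands for
`k = j + 1`: this is `χ_[k-1,k)` for `k < n` and `χ_[n-1,∞)` for `k = n`. -/
def verticalSymbol (n : ℕ) (j : Fin n) (y : ℝ) : ℝ :=
  if j.val + 1 = n then (Ici (j.val : ℝ)).indicator 1 y
  else (Ico (j.val : ℝ) (j.val + 1)).indicator 1 y

theorem measurable_verticalSymbol (n : ℕ) (j : Fin n) : Measurable (verticalSymbol n j) := by
  unfold verticalSymbol
  split_ifs
  · exact measurable_one.indicator measurableSet_Ici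
  · exact measurable_one.indicator measurableSet_Ico

theorem norm_verticalSymbol_le (n : ℕ) (j : Fin n) (y : ℝ) : ‖verticalSymbol n j y‖ ≤ 1 := by
  unfold verticalSymbol
  split_ifs <;> exact (norm_indicator_le_norm_self _ _).trans (by simp)

/-- The symbol `a_j(z) = a_j(Im z)` as an element of `L_∞(Π)`. -/
def symbolLp (n : ℕ) (j : Fin n) : Lp ℂ ∞ (volume.restrict upperHalf) :=
  MemLp.toLp (fun z : ℂ => (verticalSymbol n j z.im : ℂ)) <|
    memLp_top_of_bound (C := 1)
      (Complex.measurable_ofReal.comp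
        ((measurable_verticalSymbol n j).comp Complex.measurable_im)).aestronglyMeasurable
      (Eventually.of_forall fun z => by
        rw [Complex.norm_real]; exact norm_verticalSymbol_le n j z.im)

/-! ### Operators on direct sums -/

/-- The operator `H^n → K^n` with operator entries `A j k : H → K`,
`(A f)_j = ∑ k, A j k f_k`, where `H^n` and `K^n` are Hilbert direct sums. -/
def blockOp {n : ℕ} {H K : Type*} [NormedAddCommGroup H] [InnerProductSpace ℂ H]
    [NormedAddCommGroup K] [InnerProductSpace ℂ K] (A : Matrix (Fin n) (Fin n) (H →L[ℂ] K)) :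
    PiLp 2 (fun _ : Fin n => H) →L[ℂ] PiLp 2 (fun _ : Fin n => K) :=
  (PiLp.continuousLinearEquiv 2 ℂ (fun _ : Fin n => K)).symm.toContinuousLinearMap ∘L
    ContinuousLinearMap.pi fun j => ∑ k, A j k ∘L PiLp.proj 2 (fun _ : Fin n => H) k

/-- `(A²(Π))^n`. -/
abbrev BergmanN (n : ℕ) : Type := PiLp 2 (fun _ : Fin n => BergmanSpace)

/-- `(L₂(ℝ₊))^n`. -/
abbrev L2PosN (n : ℕ) : Type := PiLp 2 (fun _ : Fin n => L2Pos)

/-- `P_T = (√T_{a_j} √T_{a_k})_{j,k}`, where `√` is the positive square root. -/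
def projT (n : ℕ) : BergmanN n →L[ℂ] BergmanN n :=
  blockOp fun j k =>
    CFC.sqrt (toeplitz (symbolLp n j)) * CFC.sqrt (toeplitz (symbolLp n k))

/-- `Q_{Π,(j)} f = (0, …, f_j, …, 0)`. -/
def coordProj (n : ℕ) (j : Fin n) : BergmanN n →L[ℂ] BergmanN n :=
  blockOp (Matrix.single j j 1)

/-! ### Plancherel's theorem on `L¹ ∩ L²` -/

theorem lintegral_fourier_sq {h : ℝ → ℂ} (h1 : Integrable h) (h2 : MemLp h 2) :
    ∫⁻ x, ‖𝓕 h x‖ₑ ^ 2 = ∫⁻ x, ‖h x‖ₑ ^ 2 := by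
  have hcont : Continuous (𝓕 h) := VectorFourier.fourierIntegral_continuous
      Real.continuous_fourierChar continuous_inner h1
  have hae : 𝓕 h =ᵐ[volume] (𝓕 (h2.toLp h) : Lp ℂ 2 (volume : Measure ℝ)) := by
    apply ae_eq_of_integral_contDiff_smul_eq
    · exact hcont.locallyIntegrable
    · exact (Lp.memLp (𝓕 (h2.toLp h) : Lp ℂ 2 (volume : Measure ℝ))).locallyIntegrable (by norm_num)
    · intro g hg hgc
      have hg' : ContDiff ℝ _ (fun x => (g x : ℂ)) := Complex.ofRealCLM.contDiff.comp hg
      have hgc' : HasCompactSupport (fun x => (g x : ℂ)) := hgc.comp_left (g := Complex.ofReal) rfl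
      set S : SchwartzMap ℝ ℂ := hgc'.toSchwartzMap hg' with hS
      have hSc : ∀ x, S x = (g x : ℂ) := fun x => rfl
      have t := congrArg (fun T : TemperedDistribution ℝ ℂ => T S)
        (Lp.fourier_toTemperedDistribution_eq (h2.toLp h))
      simp only [TemperedDistribution.fourier_apply, Lp.toTemperedDistribution_apply] at t
      have e2 : ∫ x, g x • (𝓕 (h2.toLp h) : Lp ℂ 2 (volume : Measure ℝ)) x =
          ∫ x, S x • (𝓕 (h2.toLp h) : Lp ℂ 2 (volume : Measure ℝ)) x := by
        simp [hSc]
      rw [e2, ← t]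
      have e3 : ∫ x, (𝓕 S) x • (h2.toLp h) x = ∫ x, (𝓕 S) x • h x := by
        apply integral_congr_ae
        filter_upwards [h2.coeFn_toLp] with x hx
        rw [hx]
      rw [e3]
      have := VectorFourier.integral_bilin_fourierIntegral_eq_flip (ContinuousLinearMap.lsmul ℂ ℂ) (L := innerₗ ℝ)
        (μ := (volume : Measure ℝ)) (ν := (volume : Measure ℝ)) (f := S) (g := h) (e := Real.fourierChar)
        Real.continuous_fourierChar continuous_inner S.integrable h1
      have e4 : ∀ x, (𝓕 S : SchwartzMap ℝ ℂ) x =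
          VectorFourier.fourierIntegral Real.fourierChar volume (innerₗ ℝ) S x := by
        intro x; rw [SchwartzMap.fourier_coe]; rfl
      have e5 : 𝓕 h = VectorFourier.fourierIntegral Real.fourierChar volume (innerₗ ℝ) h := rfl
      simp only [e5, e4]
      simpa [hSc] using this.symm
  have hn : ‖(𝓕 (h2.toLp h) : Lp ℂ 2 (volume : Measure ℝ))‖ₑ = ‖h2.toLp h‖ₑ := by
    rw [← ofReal_norm, Lp.norm_fourier_eq, ofReal_norm]
  have sq : ∀ F : Lp ℂ 2 (volume : Measure ℝ), ‖F‖ₑ ^ 2 = ∫⁻ x, ‖F x‖ₑ ^ 2 := by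
    intro F
    rw [Lp.enorm_def, eLpNorm_eq_lintegral_rpow_enorm_toReal (by norm_num) (by norm_num),
        ← ENNReal.rpow_natCast, ← ENNReal.rpow_mul]
    simp
  have h3 := congrArg (· ^ 2) hn
  simp only [sq] at h3
  calc _ = ∫⁻ x, ‖(𝓕 (h2.toLp h) : Lp ℂ 2 (volume : Measure ℝ)) x‖ₑ ^ 2 := by
        apply lintegral_congr_ae; filter_upwards [hae] with x hx; rw [hx]
    _ = _ := h3
    _ = _ := by apply lintegral_congr_ae; filter_upwards [h2.coeFn_toLp] with x hx; rw [hx]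

/-! ### The Bargmann-type transform -/

/-- The Laguerre function `ℓ₀(y) = e^{-y/2}` of `y > 0`. -/
def laguerreZero (y : ℝ) : ℝ := Real.exp (-y / 2)

/-- `e^{ixt} √(2t) ℓ₀(2ty)` for `z = x + iy`. -/
def bargmannKernel (z : ℂ) (t : ℝ) : ℂ :=
  Complex.exp (I * (z.re * t)) * ((Real.sqrt (2 * t) * laguerreZero (2 * t * z.im) : ℝ) : ℂ)

/-- `(R₁^* f)(z) = (2π)^{-1/2} ∫_{ℝ₊} e^{ixt} √(2t) ℓ₀(2ty) f(t) dt` for `z = x + iy`. -/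
def bargmannInv (f : ℝ → ℂ) (z : ℂ) : ℂ :=
  ((Real.sqrt (2 * Real.pi))⁻¹ : ℝ) * ∫ t in Ioi (0 : ℝ), bargmannKernel z t * f t

theorem norm_bargmannKernel (z : ℂ) (t : ℝ) :
    ‖bargmannKernel z t‖ = Real.sqrt (2 * t) * Real.exp (-(t * z.im)) := by
  have h : I * (z.re * t : ℂ) = ((z.re * t : ℝ) : ℂ) * I := by push_cast; ring
  rw [bargmannKernel, norm_mul, h, Complex.norm_exp_ofReal_mul_I, one_mul, Complex.norm_real,
    laguerreZero, Real.norm_of_nonneg (by positivity)]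
  congr 2; ring

theorem measurable_bargmannKernel : Measurable fun p : ℂ × ℝ => bargmannKernel p.1 p.2 := by
  unfold bargmannKernel laguerreZero
  fun_prop

theorem lintegral_sq_lt_top (f : L2Pos) : ∫⁻ t in Ioi (0 : ℝ), ‖f t‖ₑ ^ 2 < ∞ := by
  have h := (Lp.memLp f).2
  rw [eLpNorm_lt_top_iff_lintegral_rpow_enorm_lt_top (by norm_num) (by norm_num)] at h
  simpa using h

theorem memLp_bargmannKernel {z : ℂ} (hz : 0 < z.im) :
    MemLp (bargmannKernel z) 2 (volume.restrict (Ioi 0)) := by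
  have hm : Measurable (bargmannKernel z) := by
    unfold bargmannKernel laguerreZero
    fun_prop
  rw [memLp_two_iff_integrable_sq_norm hm.aestronglyMeasurable]
  have h := (Real.GammaIntegral_convergent (s := 2) (by norm_num))
  have h2 : IntegrableOn (fun t : ℝ => t ^ (1 : ℝ) * Real.exp (-(2 * z.im) * t ^ (1 : ℝ))) (Ioi 0) :=
    integrableOn_rpow_mul_exp_neg_mul_rpow (by norm_num) (by norm_num) (by linarith)
  refine (h2.const_mul 2).congr ?_
  filter_upwards [ae_restrict_mem measurableSet_Ioi] with t ht
  have ht' : (0 : ℝ) < t := ht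
  rw [norm_bargmannKernel, mul_pow, Real.sq_sqrt (by linarith), ← Real.exp_nat_mul]
  simp only [Real.rpow_one]
  rw [mul_assoc]
  congr 3; push_cast; ring

theorem integrable_bargmann (f : L2Pos) {z : ℂ} (hz : 0 < z.im) :
    IntegrableOn (fun t => bargmannKernel z t * f t) (Ioi 0) :=
  MemLp.integrable_mul (memLp_bargmannKernel hz) (Lp.memLp f)

theorem lintegral_bargmannInv_line (f : L2Pos) {y : ℝ} (hy : 0 < y) :
    ∫⁻ x : ℝ, ‖bargmannInv f (x + y * I)‖ₑ ^ 2 =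
      ∫⁻ t in Ioi (0 : ℝ), ENNReal.ofReal (2 * t * Real.exp (-(2 * t * y))) * ‖f t‖ₑ ^ 2 := by
  set h : ℝ → ℂ := (Ioi (0 : ℝ)).indicator fun t => bargmannKernel (y * I) t * f t with hh
  have hy' : 0 < (y * I : ℂ).im := by simpa using hy
  have hsq : ∀ t, 0 < t → ‖bargmannKernel (y * I) t‖ₑ ^ 2 =
      ENNReal.ofReal (2 * t * Real.exp (-(2 * t * y))) := by
    intro t ht
    rw [← ofReal_norm, norm_bargmannKernel, ← ENNReal.ofReal_pow (by positivity), mul_pow,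
      Real.sq_sqrt (by linarith), ← Real.exp_nat_mul]
    congr 3; simp; ring
  have h1 : Integrable h := (integrable_indicator_iff measurableSet_Ioi).2 (integrable_bargmann f hy')
  have hL : ∫⁻ t, ‖h t‖ₑ ^ 2 =
      ∫⁻ t in Ioi (0 : ℝ), ENNReal.ofReal (2 * t * Real.exp (-(2 * t * y))) * ‖f t‖ₑ ^ 2 := by
    rw [← lintegral_indicator measurableSet_Ioi]
    refine lintegral_congr fun t => ?_
    by_cases ht : t ∈ Ioi (0 : ℝ)
    · simp only [hh, Set.indicator_of_mem ht]
      rw [enorm_mul, mul_pow, hsq t ht]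
    · simp [hh, Set.indicator_of_notMem ht]
  have h2 : MemLp h 2 := by
    refine ⟨h1.aestronglyMeasurable, ?_⟩
    rw [eLpNorm_lt_top_iff_lintegral_rpow_enorm_lt_top (by norm_num) (by norm_num)]
    simp only [ENNReal.toReal_ofNat, ENNReal.rpow_ofNat]
    rw [hL]
    calc _ ≤ ∫⁻ t in Ioi (0 : ℝ), ENNReal.ofReal (1 / y) * ‖f t‖ₑ ^ 2 := by
          refine setLIntegral_mono' measurableSet_Ioi fun t ht => ?_
          gcongr
          have ht' : (0 : ℝ) < t := ht
          have e := Real.add_one_le_exp (2 * t * y)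
          rw [Real.exp_neg, ← div_eq_mul_inv, div_le_div_iff₀ (Real.exp_pos _) hy]
          linarith
      _ = ENNReal.ofReal (1 / y) * ∫⁻ t in Ioi (0 : ℝ), ‖f t‖ₑ ^ 2 :=
          lintegral_const_mul' _ _ ENNReal.ofReal_ne_top
      _ < ∞ := ENNReal.mul_lt_top ENNReal.ofReal_lt_top (lintegral_sq_lt_top f)
  have hpt : ∀ x : ℝ, bargmannInv f (x + y * I) =
      ((Real.sqrt (2 * Real.pi))⁻¹ : ℝ) * 𝓕 h ((-(2 * Real.pi)⁻¹) * x) := by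
    intro x
    rw [bargmannInv, Real.fourier_real_eq_integral_exp_smul, ← integral_indicator measurableSet_Ioi]
    congr 1
    refine integral_congr_ae (Eventually.of_forall fun t => ?_)
    by_cases ht : t ∈ Ioi (0 : ℝ)
    · simp only [hh, Set.indicator_of_mem ht, bargmannKernel]
      simp only [smul_eq_mul]
      have e1 : I * (((x + y * I : ℂ).re : ℂ) * (t : ℂ)) =
          ((-2 * Real.pi * t * (-(2 * Real.pi)⁻¹ * x) : ℝ) : ℂ) * I := by
        have : (Real.pi : ℂ) ≠ 0 := by exact_mod_cast Real.pi_ne_zero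
        simp
        field_simp
      rw [e1]
      simp [mul_assoc]
    · simp [hh, Set.indicator_of_notMem ht]
  have hscale : ∫⁻ x : ℝ, ‖𝓕 h ((-(2 * Real.pi)⁻¹) * x)‖ₑ ^ 2 =
      ENNReal.ofReal (2 * Real.pi) * ∫⁻ x, ‖𝓕 h x‖ₑ ^ 2 := by
    have hne : (-(2 * Real.pi)⁻¹) ≠ 0 := by
      have := Real.pi_pos
      simp [this.ne']
    have := (Homeomorph.mulLeft₀ _ hne).measurableEmbedding.lintegral_map
      (μ := volume) (fun x => ‖𝓕 h x‖ₑ ^ 2)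
    simp only [Homeomorph.coe_mulLeft₀] at this
    rw [← this, Real.map_volume_mul_left hne, lintegral_smul_measure, smul_eq_mul]
    congr 2
    rw [inv_neg, inv_inv, abs_neg, abs_of_pos (by positivity)]
  simp only [hpt, enorm_mul, mul_pow]
  rw [lintegral_const_mul' _ _ (by finiteness), hscale, lintegral_fourier_sq h1 h2, hL, ← mul_assoc]
  convert one_mul _
  rw [← ofReal_norm, ← ENNReal.ofReal_pow (norm_nonneg _), ← ENNReal.ofReal_mul (by positivity),
    Complex.norm_real, Real.norm_of_nonneg (by positivity), inv_pow, Real.sq_sqrt (by positivity),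
    inv_mul_cancel₀ (by positivity), ENNReal.ofReal_one]

theorem measurable_bargmannInv (f : L2Pos) : StronglyMeasurable (bargmannInv f) := by
  unfold bargmannInv
  apply StronglyMeasurable.const_mul
  apply StronglyMeasurable.integral_prod_right (f := fun z t => bargmannKernel z t * f t)
  exact (measurable_bargmannKernel.stronglyMeasurable).mul
    ((Lp.stronglyMeasurable f).comp_measurable measurable_snd)

theorem lintegral_bargmannInv (f : L2Pos) :
    ∫⁻ z in upperHalf, ‖bargmannInv f z‖ₑ ^ 2 = ∫⁻ t in Ioi (0 : ℝ), ‖f t‖ₑ ^ 2 := by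
  have hm := ((measurable_bargmannInv f).measurable.enorm.pow_const 2)
  have hfm := ((Lp.stronglyMeasurable f).measurable.enorm.pow_const 2)
  have e1 : ∫⁻ z in upperHalf, ‖bargmannInv f z‖ₑ ^ 2 =
      ∫⁻ y in Ioi (0 : ℝ), ∫⁻ x : ℝ, ‖bargmannInv f (x + y * I)‖ₑ ^ 2 := by
    rw [← Complex.volume_preserving_equiv_real_prod.symm.setLIntegral_comp_preimage
      isOpen_upperHalf.measurableSet hm]
    have : (Complex.measurableEquivRealProd.symm ⁻¹' upperHalf) = univ ×ˢ Ioi (0 : ℝ) := by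
      ext p; simp [Complex.measurableEquivRealProd]
    rw [this, Measure.volume_eq_prod, ← Measure.prod_restrict, Measure.restrict_univ,
      lintegral_prod_symm _ (by
        exact (hm.comp Complex.measurableEquivRealProd.symm.measurable).aemeasurable)]
    refine lintegral_congr fun y => lintegral_congr fun x => ?_
    congr 3
    apply Complex.ext <;> simp [Complex.measurableEquivRealProd]
  rw [e1, setLIntegral_congr_fun measurableSet_Ioi fun y hy => lintegral_bargmannInv_line f hy]
  rw [lintegral_lintegral_swap (by
    apply Measurable.aemeasurable
    apply Measurable.mul (by fun_prop) (hfm.comp measurable_snd))]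
  refine setLIntegral_congr_fun measurableSet_Ioi fun t ht => ?_
  have ht' : (0 : ℝ) < t := ht
  rw [lintegral_mul_const _ (by fun_prop)]
  convert one_mul _
  have hi : IntegrableOn (fun y => Real.exp (-(2 * t) * y)) (Ioi 0) :=
    exp_neg_integrableOn_Ioi 0 (by linarith)
  have hv : ∫ y in Ioi (0 : ℝ), Real.exp (-(2 * t) * y) = (2 * t)⁻¹ := by
    rw [integral_exp_mul_Ioi (by linarith)]
    simp
  have : ∀ y, 2 * t * Real.exp (-(2 * t * y)) = 2 * t * Real.exp (-(2 * t) * y) := by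
    intro y; congr 2; ring
  simp only [this]
  rw [← ofReal_integral_eq_lintegral_ofReal (hi.const_mul _)
    (Eventually.of_forall fun y => by positivity), integral_const_mul, hv,
    mul_inv_cancel₀ (by positivity), ENNReal.ofReal_one]

theorem memLp_bargmannInv (f : L2Pos) : MemLp (bargmannInv f) 2 (volume.restrict upperHalf) := by
  refine ⟨(measurable_bargmannInv f).aestronglyMeasurable, ?_⟩
  rw [eLpNorm_lt_top_iff_lintegral_rpow_enorm_lt_top (by norm_num) (by norm_num)]
  simp only [ENNReal.toReal_ofNat, ENNReal.rpow_ofNat]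
  rw [lintegral_bargmannInv]
  exact lintegral_sq_lt_top f

/-- The isometric embedding `R₁^* : L₂(ℝ₊) → L₂(Π)`. -/
def bargmannAdj : L2Pos →ₗᵢ[ℂ] L2Plane where
  toFun f := (memLp_bargmannInv f).toLp _
  map_add' f g := by
    rw [← MemLp.toLp_add]
    apply MemLp.toLp_congr
    filter_upwards [ae_restrict_mem isOpen_upperHalf.measurableSet] with z hz
    simp only [Pi.add_apply, bargmannInv]
    rw [← mul_add, ← integral_add (integrable_bargmann f hz) (integrable_bargmann g hz)]
    congr 1
    apply integral_congr_ae
    filter_upwards [Lp.coeFn_add f g] with t ht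
    rw [ht, Pi.add_apply, mul_add]
  map_smul' c f := by
    rw [RingHom.id_apply, ← MemLp.toLp_const_smul]
    apply MemLp.toLp_congr
    filter_upwards with z
    simp only [Pi.smul_apply, bargmannInv, smul_eq_mul]
    rw [mul_left_comm c, ← integral_const_mul c]
    congr 1
    apply integral_congr_ae
    filter_upwards [Lp.coeFn_smul c f] with t ht
    rw [ht, Pi.smul_apply, smul_eq_mul, mul_left_comm]
  norm_map' f := by
    rw [LinearMap.coe_mk, AddHom.coe_mk, Lp.norm_toLp, Lp.norm_def]
    congr 1
    simp only [eLpNorm_eq_lintegral_rpow_enorm_toReal (p := 2) (by norm_num) (by norm_num),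
      ENNReal.toReal_ofNat, ENNReal.rpow_ofNat]
    rw [lintegral_bargmannInv]

/-- `R₁` restricted to `A²(Π)`, where `R₁ : L₂(Π) → L₂(ℝ₊)` is the adjoint of `R₁^*`. -/
def bargmann : BergmanSpace →L[ℂ] L2Pos :=
  ContinuousLinearMap.adjoint bargmannAdj.toContinuousLinearMap ∘L bergmanIncl

/-- `R = R₁ ⊕ ⋯ ⊕ R₁ : (A²(Π))^n → (L₂(ℝ₊))^n`. -/
def bargmannN (n : ℕ) : BergmanN n →L[ℂ] L2PosN n :=
  blockOp (Matrix.diagonal fun _ => bargmann)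

/-! ### The functions `γ^{a_j}` on `[0, ∞]` -/

/-- `γ^{a_j}(x) = ∫_{ℝ₊} a_j(y / (2|x|)) ℓ₀(y)² dy`. -/
def gammaFun (n : ℕ) (j : Fin n) (x : ℝ) : ℝ :=
  ∫ y in Ioi (0 : ℝ), verticalSymbol n j (y / (2 * |x|)) * laguerreZero y ^ 2

theorem laguerreZero_sq (y : ℝ) : laguerreZero y ^ 2 = Real.exp (-y) := by
  rw [laguerreZero, ← Real.exp_nat_mul]; congr 1; push_cast; ring

theorem integral_exp_neg_Ici {a : ℝ} : ∫ y in Ici a, Real.exp (-y) = Real.exp (-a) := by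
  rw [integral_Ici_eq_integral_Ioi, integral_exp_neg_Ioi]

theorem gammaFun_last {n : ℕ} {j : Fin n} (hj : j.val + 1 = n) {x : ℝ} (hx : 0 < x) :
    gammaFun n j x = Real.exp (-(2 * j.val * x)) := by
  rw [← integral_exp_neg_Ici, integral_Ici_eq_integral_Ioi, gammaFun,
    ← integral_Ici_eq_integral_Ioi, ← integral_Ici_eq_integral_Ioi,
    ← integral_indicator measurableSet_Ici, ← integral_indicator measurableSet_Ici]
  congr 1
  ext y
  have h0 : (0 : ℝ) ≤ 2 * j.val * x := by positivity
  have e : (j.val : ℝ) ≤ y / (2 * |x|) ↔ 2 * j.val * x ≤ y := by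
    rw [abs_of_pos hx, le_div_iff₀ (by positivity)]
    constructor <;> intro h <;> linarith
  by_cases h : 2 * j.val * x ≤ y
  · simp [verticalSymbol, hj, Set.indicator, e, h, h0.trans h, laguerreZero_sq]
  · simp [verticalSymbol, hj, Set.indicator, e, h]

theorem gammaFun_of_ne {n : ℕ} {j : Fin n} (hj : j.val + 1 ≠ n) {x : ℝ} (hx : 0 < x) :
    gammaFun n j x = Real.exp (-(2 * j.val * x)) - Real.exp (-(2 * (j.val + 1) * x)) := by
  have h0 : (0 : ℝ) ≤ 2 * j.val * x := by positivity
  have h1 : 2 * (j.val : ℝ) * x ≤ 2 * (j.val + 1) * x := by nlinarith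
  have hI : ∫ y in (2 * j.val * x)..(2 * (j.val + 1) * x), Real.exp (-y) =
      Real.exp (-(2 * j.val * x)) - Real.exp (-(2 * (j.val + 1) * x)) := by
    rw [intervalIntegral.integral_comp_neg (fun y => Real.exp y), integral_exp]
  rw [← hI, intervalIntegral.integral_of_le h1, integral_Ioc_eq_integral_Ioo,
    ← integral_Ico_eq_integral_Ioo, gammaFun, ← integral_Ici_eq_integral_Ioi,
    ← integral_indicator measurableSet_Ici, ← integral_indicator measurableSet_Ico]
  congr 1
  ext y
  have e : (j.val : ℝ) ≤ y / (2 * |x|) ↔ 2 * j.val * x ≤ y := by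
    rw [abs_of_pos hx, le_div_iff₀ (by positivity)]
    constructor <;> intro h <;> linarith
  have e' : y / (2 * |x|) < (j.val : ℝ) + 1 ↔ y < 2 * (j.val + 1) * x := by
    rw [abs_of_pos hx, div_lt_iff₀ (by positivity)]
    constructor <;> intro h <;> linarith
  by_cases h : 2 * j.val * x ≤ y
  · simp [verticalSymbol, hj, Set.indicator, e, e', h, h0.trans h, laguerreZero_sq]
  · simp [verticalSymbol, hj, Set.indicator, e, h]

/-- `e^{-ct}` on `[0, ∞]`. -/
def expNeg (c : ℕ) (t : ℝ≥0∞) : ℝ := (EReal.exp (-((c * t : ℝ≥0∞) : EReal))).toReal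

theorem continuous_expNeg (c : ℕ) : Continuous (expNeg c) := by
  have h : Continuous fun t : ℝ≥0∞ => EReal.exp (-((c * t : ℝ≥0∞) : EReal)) :=
    ENNReal.continuous_exp.comp (continuous_neg.comp
      (continuous_coe_ennreal_ereal.comp (ENNReal.continuous_const_mul (by simp))))
  refine continuous_iff_continuousAt.2 fun t => ?_
  refine (ENNReal.tendsto_toReal ?_).comp h.continuousAt
  rw [Ne, EReal.exp_eq_top_iff, EReal.neg_eq_top_iff]
  exact EReal.coe_ennreal_ne_bot _

theorem expNeg_of_ne_top (c : ℕ) {t : ℝ≥0∞} (ht : t ≠ ∞) :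
    expNeg c t = Real.exp (-(c * t.toReal)) := by
  lift t to NNReal using ht
  have : (((c : ℝ≥0∞) * (t : ℝ≥0∞) : ℝ≥0∞) : EReal) = ((c * t : ℝ) : EReal) := by
    push_cast
    rfl
  rw [expNeg, this, ← EReal.coe_neg, EReal.exp_coe, ENNReal.toReal_ofReal (Real.exp_pos _).le]
  simp

theorem expNeg_top (c : ℕ) : expNeg c ∞ = if c = 0 then 1 else 0 := by
  split_ifs with h
  · simp [expNeg, h]
  · simp [expNeg, ENNReal.mul_top, h]

/-- The continuous extension of `γ^{a_j}` to `[0, ∞]`. -/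
def gamma (n : ℕ) (j : Fin n) : C(ℝ≥0∞, ℝ) where
  toFun t :=
    if t = 0 then (if j.val + 1 = n then 1 else 0)
    else if t = ∞ then (if j.val = 0 then 1 else 0)
    else gammaFun n j t.toReal
  continuous_toFun := by
    by_cases hj : j.val + 1 = n
    · refine (continuous_expNeg (2 * j.val)).congr fun t => ?_
      rcases eq_or_ne t 0 with rfl | h0
      · simp [hj, expNeg_of_ne_top]
      rcases eq_or_ne t ∞ with rfl | ht
      · simp [expNeg_top]
      · simp [h0, ht, gammaFun_last hj (ENNReal.toReal_pos h0 ht), expNeg_of_ne_top]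
    · refine ((continuous_expNeg (2 * j.val)).sub (continuous_expNeg (2 * (j.val + 1)))).congr
        fun t => ?_
      rcases eq_or_ne t 0 with rfl | h0
      · simp [hj, expNeg_of_ne_top]
      rcases eq_or_ne t ∞ with rfl | ht
      · simp [expNeg_top]
      · simp [h0, ht, gammaFun_of_ne hj (ENNReal.toReal_pos h0 ht), expNeg_of_ne_top]

/-! ### Matrix-valued functions on `[0, ∞]` -/

/-- `M_n(ℂ) ⊗ C[0, ∞]`: continuous functions on `[0, ∞]` with values in `M_n(ℂ)`, with the
supremum of the operator norms. -/
abbrev MatrixFun (n : ℕ) : Type := C(ℝ≥0∞, Matrix (Fin n) (Fin n) ℂ)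

/-- `P_γ = (√γ^{a_j} √γ^{a_k})_{j,k}`. -/
def projGamma (n : ℕ) : MatrixFun n where
  toFun t := Matrix.of fun j k =>
    ((Real.sqrt (gamma n j t) * Real.sqrt (gamma n k t) : ℝ) : ℂ)
  continuous_toFun := by
    refine continuous_matrix fun j k => ?_
    simp only [Matrix.of_apply]
    fun_prop

/-- `Q_j`, the constant matrix unit `E_{jj}`. -/
def projConst (n : ℕ) (j : Fin n) : MatrixFun n :=
  ContinuousMap.const _ (Matrix.single j j 1)

/-- `D_n^{1,n}`: the functions `M` with `M(0)`, `M(∞)` diagonal and `M_{kk}(0) = M_{kk}(∞)` for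
`1 < k < n` (with `k = j + 1`). -/
def algD (n : ℕ) : StarSubalgebra ℂ (MatrixFun n) where
  carrier := {M | (M 0).IsDiag ∧ (M ∞).IsDiag ∧
    ∀ j : Fin n, 0 < j.val → j.val + 1 < n → M 0 j j = M ∞ j j}
  mul_mem' := by
    rintro M N ⟨h1, h2, h3⟩ ⟨k1, k2, k3⟩
    have aux : ∀ t, (M t).IsDiag → (N t).IsDiag → (M t * N t).IsDiag ∧
        ∀ j, (M t * N t) j j = M t j j * N t j j := by
      intro t h k
      constructor
      · rw [← h.diagonal_diag, ← k.diagonal_diag, Matrix.diagonal_mul_diagonal]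
        exact Matrix.isDiag_diagonal _
      · intro j
        rw [Matrix.mul_apply, Finset.sum_eq_single j]
        · intro i _ hi
          rw [h hi.symm, zero_mul]
        · simp
    refine ⟨(aux 0 h1 k1).1, (aux ∞ h2 k2).1, fun j hj hj' => ?_⟩
    simp only [ContinuousMap.mul_apply]
    rw [(aux 0 h1 k1).2, (aux ∞ h2 k2).2, h3 j hj hj', k3 j hj hj']
  add_mem' := by
    rintro M N ⟨h1, h2, h3⟩ ⟨k1, k2, k3⟩
    exact ⟨h1.add k1, h2.add k2, fun j hj hj' => by simp [h3 j hj hj', k3 j hj hj']⟩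
  algebraMap_mem' := by
    intro c
    refine ⟨?_, ?_, fun j _ _ => ?_⟩
    · intro i j h
      simp [Algebra.algebraMap_eq_smul_one, h]
    · intro i j h
      simp [Algebra.algebraMap_eq_smul_one, h]
    · simp [Algebra.algebraMap_eq_smul_one]
  star_mem' := by
    rintro M ⟨h1, h2, h3⟩
    exact ⟨h1.conjTranspose, h2.conjTranspose,
      fun j hj hj' => by simp [Matrix.star_apply, h3 j hj hj']⟩

/-- The entry `M_{jk}` of a matrix-valued function. -/
def entry {n : ℕ} (M : MatrixFun n) (j k : Fin n) : C(ℝ≥0∞, ℂ) where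
  toFun t := M t j k
  continuous_toFun := (continuous_apply_apply j k).comp M.continuous

/-- The restriction of `M_{jk}` to `ℝ₊` as an element of `L_∞(ℝ₊)`. -/
def entryLp {n : ℕ} (M : MatrixFun n) (j k : Fin n) : Lp ℂ ∞ (volume.restrict (Ioi (0 : ℝ))) :=
  MemLp.toLp (fun x : ℝ => M (ENNReal.ofReal x) j k) <|
    memLp_top_of_bound (C := ‖entry M j k‖)
      ((entry M j k).continuous.comp ENNReal.continuous_ofReal).aestronglyMeasurable
      (Eventually.of_forall fun x => (entry M j k).norm_coe_le_norm (ENNReal.ofReal x))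

/-- The operator of multiplication by the matrix-valued function `M` on `(L₂(ℝ₊))^n`. -/
def matrixMul {n : ℕ} (M : MatrixFun n) : L2PosN n →L[ℂ] L2PosN n :=
  blockOp fun j k => mulLp (entryLp M j k)

/-! ### Generated `C^*`-algebras -/

/-- The `C^*`-algebra generated by `s`: the smallest norm-closed `*`-subalgebra containing `s`. -/
def cstarGenerated {A : Type*} [NormedRing A] [StarRing A] [NormedAlgebra ℂ A] [StarModule ℂ A]
    [ContinuousStar A] (s : Set A) : NonUnitalStarSubalgebra ℂ A :=
  (NonUnitalStarAlgebra.adjoin ℂ s).topologicalClosure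

theorem subset_cstarGenerated {A : Type*} [NormedRing A] [StarRing A] [NormedAlgebra ℂ A]
    [StarModule ℂ A] [ContinuousStar A] (s : Set A) : s ⊆ cstarGenerated s :=
  (NonUnitalStarAlgebra.subset_adjoin ℂ s).trans
    (NonUnitalStarSubalgebra.le_topologicalClosure _)

/-- `C^*(P_T; Q_{Π,(1)}, …, Q_{Π,(n)})`. -/
abbrev algT (n : ℕ) : NonUnitalStarSubalgebra ℂ (BergmanN n →L[ℂ] BergmanN n) :=
  cstarGenerated (insert (projT n) (range (coordProj n)))

/-! Shortcut instances, to speed up type class inference. -/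

instance (n : ℕ) : Add (algT n) := inferInstance

instance (n : ℕ) : Mul (algT n) := inferInstance

set_option synthInstance.maxHeartbeats 400000 in
instance (n : ℕ) : SMul ℂ (algT n) := inferInstance

theorem projT_mem (n : ℕ) : projT n ∈ algT n :=
  subset_cstarGenerated _ (mem_insert _ _)

theorem coordProj_mem (n : ℕ) (j : Fin n) : coordProj n j ∈ algT n :=
  subset_cstarGenerated _ (mem_insert_of_mem _ (mem_range_self j))

/-- `C^*(P_γ; Q_1, …, Q_n)`. -/
abbrev algGamma (n : ℕ) : NonUnitalStarSubalgebra ℂ (MatrixFun n) :=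
  cstarGenerated (insert (projGamma n) (range (projConst n)))

end PolyBergman

end

/-! The proof has two independent halves, joined by a unitary equivalence. Function side. With the
indices running from 1 to n, γ^{a_1} = 1 - e^{-2t}, γ^{a_n} = e^{-2(n-1)t}, and each middle γ^{a_j}
is a difference of exponentials. All are positive on (0,∞); at 0 only γ^{a_n} survives, at ∞ only
γ^{a_1}, so P_γ satisfies the endpoint conditions. For the converse, Q_j P_γ Q_k isolates the entry
√γ^{a_j} √γ^{a_k} E_{jk}. Since γ^{a_1} and γ^{a_n} are injective, Stone–Weierstrass gives f E_{jj}
for every continuous f when j is 1 or n (`singleFun_diag_mem`). Multiplying through the index 1 puts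
into position (j,k) the ideal generated by a function whose only zeros are 0 and ∞; its closure
consists of all functions vanishing at both ends (`singleFun_mem_of_vanish`). Constants times Q_j
supply the rest of the middle diagonal entries (`algGamma_eq_algD`). Operator side. R₁^* is an
isometry with holomorphic values. Its range is all of the Bergman space because it contains
multiples of the Bergman kernels, whose reproducing property is the mean value property of the disc
carried over by the Cayley transform. So R₁ is unitary on the Bergman space. Plancherel on
horizontal lines shows that it turns T_{a_j} into multiplication by γ^{a_j}
(`bargmann_toeplitz_adjoint`), hence √T_{a_j} into multiplication by √γ^{a_j} (`sqrt_toeplitz`).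
Therefore M ↦ R^* M R (`bergmanRep`) is an injective, hence isometric, *-homomorphism taking
generators to generators, and it maps one generated C*-algebra onto the other (`mem_algT_iff`). The
required isomorphism is its inverse. -/

noncomputable section

namespace PolyBergman

/-! ### Endpoint values, positivity and injectivity of γ^{a_j} -/

theorem gamma_zero (n : ℕ) (j : Fin n) : gamma n j 0 = if j.val + 1 = n then 1 else 0 := if_pos rfl

theorem gamma_top (n : ℕ) (j : Fin n) : gamma n j ∞ = if j.val = 0 then 1 else 0 := by
  simp [gamma]

theorem gamma_last {n : ℕ} {j : Fin n} (hj : j.val + 1 = n) (t : ℝ≥0∞) :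
    gamma n j t = expNeg (2 * j.val) t := by
  rcases eq_or_ne t 0 with rfl | h0
  · simp [gamma_zero, hj, expNeg_of_ne_top]
  rcases eq_or_ne t ∞ with rfl | ht
  · simp [gamma_top, expNeg_top]
  · simp [gamma, h0, ht, gammaFun_last hj (ENNReal.toReal_pos h0 ht), expNeg_of_ne_top]

/-- The exponential formula persists at the endpoints. For j = 0 the first term is 1 even at ∞,
since 0 * ∞ = 0 in `ℝ≥0∞`. -/
theorem gamma_of_ne {n : ℕ} {j : Fin n} (hj : j.val + 1 ≠ n) (t : ℝ≥0∞) :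
    gamma n j t = expNeg (2 * j.val) t - expNeg (2 * (j.val + 1)) t := by
  rcases eq_or_ne t 0 with rfl | h0
  · simp [gamma_zero, hj, expNeg_of_ne_top]
  rcases eq_or_ne t ∞ with rfl | ht
  · simp [gamma_top, expNeg_top]
  · simp [gamma, h0, ht, gammaFun_of_ne hj (ENNReal.toReal_pos h0 ht), expNeg_of_ne_top]

theorem gamma_pos (n : ℕ) (j : Fin n) {t : ℝ≥0∞} (h0 : t ≠ 0) (ht : t ≠ ∞) : 0 < gamma n j t := by
  have h := ENNReal.toReal_pos h0 ht
  by_cases hj : j.val + 1 = n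
  · rw [gamma_last hj, expNeg_of_ne_top _ ht]
    exact Real.exp_pos _
  · rw [gamma_of_ne hj, expNeg_of_ne_top _ ht, expNeg_of_ne_top _ ht, sub_pos, Real.exp_lt_exp]
    push_cast
    nlinarith

theorem gamma_nonneg (n : ℕ) (j : Fin n) (t : ℝ≥0∞) : 0 ≤ gamma n j t := by
  rcases eq_or_ne t 0 with rfl | h0
  · rw [gamma_zero]; positivity
  rcases eq_or_ne t ∞ with rfl | ht
  · rw [gamma_top]; positivity
  · exact (gamma_pos n j h0 ht).le

theorem expNeg_injective {c : ℕ} (hc : c ≠ 0) : Function.Injective (expNeg c) := by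
  have key : ∀ t : ℝ≥0∞, t ≠ ∞ → expNeg c t ≠ expNeg c ∞ := by
    intro t ht
    rw [expNeg_top, if_neg hc, expNeg_of_ne_top c ht]
    exact (Real.exp_pos _).ne'
  intro s t h
  by_cases hs : s = ∞
  · by_contra hne
    subst hs
    exact key t (Ne.symm hne) h.symm
  by_cases ht : t = ∞
  · subst ht
    exact absurd h (key s hs)
  rw [expNeg_of_ne_top c hs, expNeg_of_ne_top c ht, Real.exp_eq_exp, neg_inj] at h
  exact (ENNReal.toReal_eq_toReal_iff' hs ht).1 (mul_left_cancel₀ (by exact_mod_cast hc) h)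

theorem expNeg_zero_left (t : ℝ≥0∞) : expNeg 0 t = 1 := by simp [expNeg]

/-- At the two extreme indices a single nonconstant exponential remains. The middle functions vanish
at both 0 and ∞, which is why D_n^{1,n} ties these two values together. The bound on n keeps the
exponent of the last function nonzero. -/
theorem gamma_injective {n : ℕ} (hn : 2 ≤ n) {j : Fin n} (hj : j.val = 0 ∨ j.val + 1 = n) :
    Function.Injective (gamma n j) := by
  intro s t h
  by_cases hl : j.val + 1 = n
  · rw [gamma_last hl, gamma_last hl] at h
    exact expNeg_injective (by omega) h
  · have h0 : j.val = 0 := by tauto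
    rw [gamma_of_ne hl, gamma_of_ne hl] at h
    simp only [h0, mul_zero, expNeg_zero_left, sub_right_inj] at h
    exact expNeg_injective (by omega) h

/-! ### Matrix units with function coefficients -/

/-- The matrix-valued function with the entry `f` at `(j, k)` and zeros elsewhere. -/
def singleFun {n : ℕ} (j k : Fin n) : C(ℝ≥0∞, ℂ) →ₗ[ℂ] MatrixFun n where
  toFun f := ⟨fun t => Matrix.single j k (f t), by
    refine continuous_matrix fun i l => ?_
    simp only [Matrix.single_apply]
    split_ifs <;> fun_prop⟩
  map_add' f g := by ext1 t; exact Matrix.single_add j k (f t) (g t)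
  map_smul' c f := by ext1 t; exact (Matrix.smul_single c j k (f t)).symm

@[simp] theorem singleFun_apply {n : ℕ} (j k : Fin n) (f : C(ℝ≥0∞, ℂ)) (t : ℝ≥0∞) :
    singleFun j k f t = Matrix.single j k (f t) := rfl

theorem continuous_singleFun {n : ℕ} (j k : Fin n) : Continuous (singleFun (n := n) j k) := by
  have hc : Continuous fun z : ℂ => (Matrix.single j k z : Matrix (Fin n) (Fin n) ℂ) := by
    refine continuous_matrix fun i l => ?_
    simp only [Matrix.single_apply]
    split_ifs <;> fun_prop
  exact ContinuousMap.continuous_postcomp ⟨_, hc⟩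

theorem singleFun_mul {n : ℕ} (i j k : Fin n) (f g : C(ℝ≥0∞, ℂ)) :
    singleFun i j f * singleFun j k g = singleFun i k (f * g) := by
  ext1 t
  simp

theorem star_singleFun {n : ℕ} (j k : Fin n) (f : C(ℝ≥0∞, ℂ)) :
    star (singleFun j k f) = singleFun k j (star f) := by
  ext1 t
  exact Matrix.conjTranspose_single j k (f t)

theorem eq_sum_singleFun {n : ℕ} (M : MatrixFun n) :
    M = ∑ j, ∑ k, singleFun j k (entry M j k) := by
  ext1 t
  rw [ContinuousMap.sum_apply]
  simp only [ContinuousMap.sum_apply, singleFun_apply]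
  exact Matrix.matrix_eq_sum_single (M t)

/-! ### The C*-algebra generated by P_γ and the Q_j -/

/-- `√γ^{a_j}` as a complex-valued function. -/
def sqrtGamma (n : ℕ) (j : Fin n) : C(ℝ≥0∞, ℂ) :=
  ⟨fun t => (Real.sqrt (gamma n j t) : ℂ), by fun_prop⟩

theorem projGamma_compress {n : ℕ} (j k : Fin n) :
    projConst n j * projGamma n * projConst n k = singleFun j k (sqrtGamma n j * sqrtGamma n k) := by
  ext1 t
  change Matrix.single j j 1 * projGamma n t * Matrix.single k k 1 = _
  simp [projGamma, sqrtGamma]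

theorem projConst_mem (n : ℕ) (j : Fin n) : projConst n j ∈ algGamma n :=
  subset_cstarGenerated _ (mem_insert_of_mem _ (mem_range_self j))

theorem projGamma_mem (n : ℕ) : projGamma n ∈ algGamma n :=
  subset_cstarGenerated _ (mem_insert _ _)

theorem isClosed_algGamma (n : ℕ) : IsClosed (algGamma n : Set (MatrixFun n)) :=
  NonUnitalStarSubalgebra.isClosed_topologicalClosure _

theorem singleFun_sqrtGamma_mem {n : ℕ} (j k : Fin n) :
    singleFun j k (sqrtGamma n j * sqrtGamma n k) ∈ algGamma n := by
  rw [← projGamma_compress]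
  exact mul_mem (mul_mem (projConst_mem n j) (projGamma_mem n)) (projConst_mem n k)

/-- The functions `f` such that `f E_{jj}` lies in the generated algebra. -/
def diagSubalgebra {n : ℕ} (j : Fin n) : StarSubalgebra ℂ C(ℝ≥0∞, ℂ) where
  carrier := {f | singleFun j j f ∈ algGamma n}
  mul_mem' {f g} hf hg := by
    simp only [mem_ofPred_eq, ← singleFun_mul j j j] at *
    exact mul_mem hf hg
  add_mem' {f g} hf hg := by
    simp only [mem_ofPred_eq, map_add] at *
    exact add_mem hf hg
  -- The constant function 1 corresponds to the generator Q_j, so the unital form of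
  -- Stone–Weierstrass applies.
  algebraMap_mem' c := by
    simp only [mem_ofPred_eq, Algebra.algebraMap_eq_smul_one, map_smul]
    exact SMulMemClass.smul_mem c (projConst_mem n j)
  star_mem' {f} hf := by
    simp only [mem_ofPred_eq, ← star_singleFun] at *
    exact star_mem hf

/-- Stone–Weierstrass: the coefficients allowed at (j,j) form a closed unital *-subalgebra of
C[0,∞], and it contains γ^{a_j}, which separates points for extreme j. -/
theorem singleFun_diag_mem {n : ℕ} (hn : 2 ≤ n) {j : Fin n} (hj : j.val = 0 ∨ j.val + 1 = n)
    (f : C(ℝ≥0∞, ℂ)) : singleFun j j f ∈ algGamma n := by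
  have hc : IsClosed (diagSubalgebra j : Set C(ℝ≥0∞, ℂ)) :=
    (isClosed_algGamma n).preimage (continuous_singleFun j j)
  have htop : (diagSubalgebra j).topologicalClosure = ⊤ := by
    apply ContinuousMap.starSubalgebra_topologicalClosure_eq_top_of_separatesPoints
    intro s t hst
    refine ⟨_, ⟨sqrtGamma n j * sqrtGamma n j, singleFun_sqrtGamma_mem j j, rfl⟩, ?_⟩
    simp only [sqrtGamma, ContinuousMap.mul_apply, ContinuousMap.coe_mk, ← Complex.ofReal_mul,
      Real.mul_self_sqrt (gamma_nonneg n j _)]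
    exact fun h => hst (gamma_injective hn hj (Complex.ofReal_injective h))
  have : f ∈ (diagSubalgebra j).topologicalClosure := htop ▸ trivial
  exact (hc.closure_eq ▸ this : f ∈ (diagSubalgebra j : Set C(ℝ≥0∞, ℂ)))

/-- A detour through the first index, where arbitrary coefficients are available, makes the
coefficients allowed at (j,k) contain a whole ideal. A closed ideal of C[0,∞] is determined by its
common zeros, which here are among 0 and ∞. -/
theorem singleFun_mem_of_vanish {n : ℕ} (hn : 2 ≤ n) (j k : Fin n) {f : C(ℝ≥0∞, ℂ)}
    (h0 : f 0 = 0) (h1 : f ∞ = 0) : singleFun j k f ∈ algGamma n := by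
  let o : Fin n := ⟨0, by omega⟩
  set g : C(ℝ≥0∞, ℂ) := (sqrtGamma n j * sqrtGamma n o) * (sqrtGamma n o * sqrtGamma n k) with hg
  have hcl : IsClosed {f : C(ℝ≥0∞, ℂ) | singleFun j k f ∈ algGamma n} :=
    (isClosed_algGamma n).preimage (continuous_singleFun j k)
  have hsub : (Ideal.span {g} : Set C(ℝ≥0∞, ℂ)) ⊆ {f | singleFun j k f ∈ algGamma n} := by
    intro f hf
    obtain ⟨a, rfl⟩ := Ideal.mem_span_singleton'.1 hf
    -- The arbitrary multiplier a is placed in the (1,1) factor of the product E_{j1} · E_{11} ·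
    -- E_{1k}.
    have : a * g = (sqrtGamma n j * sqrtGamma n o) * (a * (sqrtGamma n o * sqrtGamma n k)) := by
      rw [hg]; ring
    rw [mem_ofPred_eq, this, ← singleFun_mul j o k, ← singleFun_mul o o k]
    exact mul_mem (singleFun_sqrtGamma_mem j o)
      (mul_mem (singleFun_diag_mem hn (Or.inl rfl) a) (singleFun_sqrtGamma_mem o k))
  refine closure_minimal hsub hcl ?_
  -- The closure of the ideal is the set of functions vanishing wherever the whole ideal does; it
  -- remains to see that g has no zero in (0,∞).
  rw [← Ideal.coe_closure, ← ContinuousMap.idealOfSet_ofIdeal_eq_closure, SetLike.mem_coe,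
    ContinuousMap.mem_idealOfSet]
  intro t ht
  rw [mem_compl_iff, ContinuousMap.notMem_setOfIdeal] at ht
  have hgt := ht (Ideal.mem_span_singleton_self g)
  rcases eq_or_ne t 0 with rfl | ht0
  · exact h0
  rcases eq_or_ne t ∞ with rfl | ht1
  · exact h1
  have hp : ∀ i, sqrtGamma n i t ≠ 0 := fun i =>
    Complex.ofReal_ne_zero.2 (Real.sqrt_pos.2 (gamma_pos n i ht0 ht1)).ne'
  simp only [hg, ContinuousMap.mul_apply, mul_eq_zero, hp, or_self] at hgt

theorem isClosed_algD (n : ℕ) : IsClosed (algD n : Set (MatrixFun n)) := by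
  have he : ∀ (t : ℝ≥0∞) (i j : Fin n), Continuous fun M : MatrixFun n => M t i j := fun t i j =>
    (continuous_apply_apply i j).comp (continuous_eval_const t)
  have hd : ∀ t : ℝ≥0∞, IsClosed {M : MatrixFun n | (M t).IsDiag} := by
    intro t
    simp only [Matrix.IsDiag, Pairwise, ofPred_forall]
    exact isClosed_iInter fun i => isClosed_iInter fun j => isClosed_iInter fun _ =>
      isClosed_eq (he t i j) continuous_const
  have hc : IsClosed {M : MatrixFun n | ∀ j : Fin n, 0 < j.val → j.val + 1 < n →
      M 0 j j = M ∞ j j} := by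
    simp only [ofPred_forall]
    exact isClosed_iInter fun j => isClosed_iInter fun _ => isClosed_iInter fun _ =>
      isClosed_eq (he 0 j j) (he ∞ j j)
  exact (hd 0).inter ((hd ∞).inter hc)

/-- P_γ equals E_{nn} at 0 and E_{11} at ∞, so the middle diagonal entries vanish at both ends. -/
theorem projGamma_mem_algD (n : ℕ) : projGamma n ∈ algD n := by
  refine ⟨fun i j hij => ?_, fun i j hij => ?_, fun j h1 h2 => ?_⟩
  · have : i.val ≠ j.val := fun h => hij (Fin.ext h)
    simp only [projGamma, gamma_zero, ContinuousMap.coe_mk, Matrix.of_apply]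
    by_cases h : i.val + 1 = n
    · have : j.val + 1 ≠ n := by omega
      simp [this]
    · simp [h]
  · have : i.val ≠ j.val := fun h => hij (Fin.ext h)
    simp only [projGamma, gamma_top, ContinuousMap.coe_mk, Matrix.of_apply]
    by_cases h : i.val = 0
    · have : j.val ≠ 0 := by omega
      simp [this]
    · simp [h]
  · simp [projGamma, gamma_zero, gamma_top, h1.ne', h2.ne]

theorem projConst_mem_algD {n : ℕ} (j : Fin n) : projConst n j ∈ algD n := by
  have h : (Matrix.single j j (1 : ℂ)).IsDiag := by
    intro i k hik
    rw [Matrix.single_apply, if_neg]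
    rintro ⟨rfl, rfl⟩
    exact hik rfl
  exact ⟨h, h, fun _ _ _ => rfl⟩

theorem algGamma_eq_algD {n : ℕ} (hn : 2 ≤ n) :
    algGamma n = (algD n).toNonUnitalStarSubalgebra := by
  apply le_antisymm
  · refine NonUnitalStarSubalgebra.topologicalClosure_minimal _
      (NonUnitalStarAlgebra.adjoin_le ?_) (isClosed_algD n)
    rintro _ (rfl | ⟨j, rfl⟩)
    · exact projGamma_mem_algD n
    · exact projConst_mem_algD j
  · rintro M ⟨h0, h1, h2⟩
    rw [eq_sum_singleFun M]
    refine sum_mem fun j _ => sum_mem fun k _ => ?_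
    rcases eq_or_ne j k with rfl | hjk
    · by_cases hj : j.val = 0 ∨ j.val + 1 = n
      · exact singleFun_diag_mem hn hj _
      · have h := h2 j (by omega) (by omega)
        -- The common endpoint value is subtracted as a multiple of Q_j; the remainder vanishes at
        -- both 0 and ∞.
        have e : entry M j j = (entry M j j - M 0 j j • 1) + M 0 j j • 1 := by abel
        rw [e, map_add, map_smul]
        refine add_mem (singleFun_mem_of_vanish hn j j ?_ ?_)
          (SMulMemClass.smul_mem _ (projConst_mem n j))
        · simp [entry]
        · simp [entry, h]
    · exact singleFun_mem_of_vanish hn j k (h0 hjk) (h1 hjk)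

/-! ### The Cayley transform and the reproducing property of the Bergman kernel -/

/-- Circle averages integrated over the radius in polar coordinates. Integrability is assumed
because g need not be bounded near the boundary circle. -/
theorem setIntegral_ball_eq_of_differentiableOn {g : ℂ → ℂ} {c : ℂ} {R : ℝ} (hR : 0 < R)
    (hg : DifferentiableOn ℂ g (Metric.ball c R)) (hi : IntegrableOn g (Metric.ball c R)) :
    ∫ z in Metric.ball c R, g z = ((Real.pi * R ^ 2 : ℝ) : ℂ) * g c := by
  have mv : ∀ r ∈ Ioo 0 R, ∫ θ in Ioo (-Real.pi) Real.pi, g (circleMap c r θ) =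
      ((2 * Real.pi : ℝ) : ℂ) * g c := by
    intro r hr
    have h1 : DiffContOnCl ℂ g (Metric.ball c |r|) := by
      rw [abs_of_pos hr.1]
      refine DifferentiableOn.diffContOnCl (hg.mono ?_)
      rw [closure_ball _ hr.1.ne']
      exact Metric.closedBall_subset_ball hr.2
    have e := ((periodic_circleMap c r).comp g).intervalIntegral_add_eq 0 (-Real.pi)
    simp only [zero_add, Function.comp_def] at e
    rw [← integral_Ioc_eq_integral_Ioo, ← intervalIntegral.integral_of_le (by linarith [Real.pi_pos]),
      ← h1.circleAverage, Real.circleAverage_def, e]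
    have : -Real.pi + 2 * Real.pi = Real.pi := by ring
    rw [this, Complex.real_smul, ← mul_assoc, ← Complex.ofReal_mul,
      mul_inv_cancel₀ (by positivity), Complex.ofReal_one, one_mul]
  set F : ℂ → ℂ := fun z => (Metric.ball c R).indicator g (c + z) with hF
  have hFi : Integrable F :=
    ((integrable_indicator_iff Metric.isOpen_ball.measurableSet).2 hi).comp_add_left c
  have hFm : Measurable F := by
    classical
    have := ContinuousOn.measurable_piecewise (s := Metric.ball c R) (f := g)
      (g := fun _ => 0) hg.continuousOn continuousOn_const Metric.isOpen_ball.measurableSet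
    rw [show (fun _ => 0 : ℂ → ℂ) = 0 from rfl, Set.piecewise_eq_indicator] at this
    exact this.comp (measurable_const_add c)
  have hsymm : ∀ p : ℝ × ℝ, c + Complex.polarCoord.symm p = circleMap c p.1 p.2 := by
    intro p
    rw [Complex.polarCoord_symm_apply, circleMap, Complex.exp_mul_I]
    push_cast; rfl
  set G : ℝ × ℝ → ℂ := fun p => p.1 • F (Complex.polarCoord.symm p) with hG
  have hGm : Measurable G := by
    refine Measurable.smul measurable_fst (hFm.comp ?_)
    have : (Complex.polarCoord.symm : ℝ × ℝ → ℂ) = fun p => circleMap 0 p.1 p.2 := by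
      ext p
      rw [Complex.polarCoord_symm_apply, circleMap, Complex.exp_mul_I]
      push_cast; simp
    rw [this]
    unfold circleMap
    fun_prop
  have hGi : IntegrableOn G Complex.polarCoord.target := by
    refine ⟨hGm.aestronglyMeasurable, ?_⟩
    have h := hFi.2
    rw [hasFiniteIntegral_iff_enorm, ← Complex.lintegral_comp_polarCoord_symm] at h
    rw [hasFiniteIntegral_iff_enorm]
    refine lt_of_le_of_lt (le_of_eq ?_) h
    refine setLIntegral_congr_fun Complex.polarCoord.open_target.measurableSet fun p hp => ?_
    rw [Complex.polarCoord_target] at hp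
    have hp1 : (0 : ℝ) < p.1 := hp.1
    rw [hG, enorm_smul, Real.enorm_of_nonneg hp1.le, smul_eq_mul]
  have hsub : Ioo 0 R ×ˢ Ioo (-Real.pi) Real.pi ⊆ Complex.polarCoord.target := by
    rw [Complex.polarCoord_target]
    exact Set.prod_mono Ioo_subset_Ioi_self subset_rfl
  have hzero : ∀ p ∈ Complex.polarCoord.target \ Ioo 0 R ×ˢ Ioo (-Real.pi) Real.pi, G p = 0 := by
    intro p hp
    have h1 : (0 : ℝ) < p.1 ∧ p.2 ∈ Ioo (-Real.pi) Real.pi := by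
      have := hp.1
      rw [Complex.polarCoord_target] at this
      exact this
    have h2 : R ≤ p.1 := not_lt.1 fun h => hp.2 ⟨⟨h1.1, h⟩, h1.2⟩
    rw [hG]
    simp only [hF, hsymm]
    rw [Set.indicator_of_notMem, smul_zero]
    simp [circleMap, abs_of_pos h1.1, h2]
  have e1 : ∫ z in Metric.ball c R, g z = ∫ z, F z := by
    rw [hF, integral_add_left_eq_self (μ := volume) (fun z => (Metric.ball c R).indicator g z) c,
      integral_indicator Metric.isOpen_ball.measurableSet]
  rw [e1, ← Complex.integral_comp_polarCoord_symm]
  change ∫ p in Complex.polarCoord.target, G p = _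
  rw [setIntegral_eq_of_subset_of_forall_sdiff_eq_zero
      Complex.polarCoord.open_target.measurableSet hsub hzero,
    Measure.volume_eq_prod, setIntegral_prod _ (by
      rw [← Measure.volume_eq_prod]; exact hGi.mono_set hsub)]
  have hint : ∫ r in Ioo 0 R, r = R ^ 2 / 2 := by
    rw [← integral_Ioc_eq_integral_Ioo, ← intervalIntegral.integral_of_le hR.le]
    simp
  calc ∫ r in Ioo 0 R, ∫ θ in Ioo (-Real.pi) Real.pi, r • F (Complex.polarCoord.symm (r, θ))
      = ∫ r in Ioo 0 R, (r : ℂ) * (((2 * Real.pi : ℝ) : ℂ) * g c) := by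
        refine setIntegral_congr_fun measurableSet_Ioo fun r hr => ?_
        rw [integral_smul, ← mv r hr, Complex.real_smul]
        congr 1
        refine integral_congr_ae (Eventually.of_forall fun θ => ?_)
        simp only [hF, hsymm]
        rw [Set.indicator_of_mem]
        simp [circleMap, abs_of_pos hr.1, hr.2]
    _ = _ := by
        rw [integral_mul_const, integral_complex_ofReal, hint]
        push_cast; ring

/-- The real Jacobian of a holomorphic map is the squared modulus of its derivative; this feeds the
change of variables along the Cayley transform. -/
theorem abs_det_restrictScalars_toSpanSingleton (a : ℂ) :
    |((ContinuousLinearMap.toSpanSingleton ℂ a).restrictScalars ℝ).det| = ‖a‖ ^ 2 := by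
  have : ((ContinuousLinearMap.toSpanSingleton ℂ a).restrictScalars ℝ).det = ‖a‖ ^ 2 := by
    rw [← Complex.normSq_eq_norm_sq, ← Algebra.norm_complex_apply, Algebra.norm_apply]
    rw [ContinuousLinearMap.det]
    congr 1
    ext; simp [mul_comm]
  rw [this, abs_of_nonneg (by positivity)]

theorem sub_conj_ne_zero {z w : ℂ} (hz : 0 < z.im) (hw : 0 < w.im) :
    z - (starRingEnd ℂ) w ≠ 0 := by
  intro h
  have := congrArg Complex.im h
  simp at this
  linarith

/-- The Cayley transform sending `w` to `0`. -/
def cayley (w z : ℂ) : ℂ := (z - w) / (z - (starRingEnd ℂ) w)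

/-- The inverse of the Cayley transform. -/
def cayleyInv (w ζ : ℂ) : ℂ := (w - (starRingEnd ℂ) w * ζ) / (1 - ζ)

theorem hasDerivAt_cayley {w z : ℂ} (hw : 0 < w.im) (hz : 0 < z.im) :
    HasDerivAt (cayley w) ((w - (starRingEnd ℂ) w) / (z - (starRingEnd ℂ) w) ^ 2) z := by
  have h := ((hasDerivAt_id z).sub_const w).div ((hasDerivAt_id z).sub_const ((starRingEnd ℂ) w))
    (sub_conj_ne_zero hz hw)
  refine h.congr_deriv ?_
  simp only [id]
  congr 1
  ring

theorem cayleyInv_cayley {w z : ℂ} (hw : 0 < w.im) (hz : 0 < z.im) :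
    cayleyInv w (cayley w z) = z := by
  have h := sub_conj_ne_zero hz hw
  have h' := sub_conj_ne_zero hw hw
  rw [cayleyInv, cayley]
  have e : 1 - (z - w) / (z - (starRingEnd ℂ) w) =
      (w - (starRingEnd ℂ) w) / (z - (starRingEnd ℂ) w) := by
    field_simp; ring
  rw [e]
  field_simp
  ring

theorem one_sub_ne_zero_of_norm_lt {ζ : ℂ} (hζ : ‖ζ‖ < 1) : 1 - ζ ≠ 0 := by
  intro h
  rw [← sub_eq_zero.1 h, norm_one] at hζ
  exact lt_irrefl _ hζ

theorem im_cayleyInv_pos {w ζ : ℂ} (hw : 0 < w.im) (hζ : ‖ζ‖ < 1) : 0 < (cayleyInv w ζ).im := by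
  have h1 : 0 < Complex.normSq (1 - ζ) := Complex.normSq_pos.2 (one_sub_ne_zero_of_norm_lt hζ)
  have h2 : Complex.normSq ζ < 1 := by
    rw [Complex.normSq_eq_norm_sq]
    nlinarith [norm_nonneg ζ]
  have : (cayleyInv w ζ).im = w.im * (1 - Complex.normSq ζ) / Complex.normSq (1 - ζ) := by
    rw [cayleyInv, Complex.div_im]
    simp [Complex.normSq_apply]
    ring
  rw [this]
  apply div_pos (mul_pos hw (by linarith)) h1

theorem cayley_cayleyInv {w ζ : ℂ} (hw : 0 < w.im) (hζ : ‖ζ‖ < 1) :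
    cayley w (cayleyInv w ζ) = ζ := by
  have h := one_sub_ne_zero_of_norm_lt hζ
  have h' := sub_conj_ne_zero hw hw
  have h2 : cayleyInv w ζ - (starRingEnd ℂ) w = (w - (starRingEnd ℂ) w) / (1 - ζ) := by
    rw [cayleyInv]; field_simp; ring
  rw [cayley, h2, cayleyInv]
  field_simp
  ring

theorem norm_cayley_lt {w z : ℂ} (hw : 0 < w.im) (hz : 0 < z.im) : ‖cayley w z‖ < 1 := by
  rw [cayley, norm_div, div_lt_one (norm_pos_iff.2 (sub_conj_ne_zero hz hw))]
  refine lt_of_pow_lt_pow_left₀ 2 (norm_nonneg _) ?_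
  rw [← Complex.normSq_eq_norm_sq, ← Complex.normSq_eq_norm_sq]
  simp only [Complex.normSq_apply, Complex.sub_re, Complex.sub_im, Complex.conj_re, Complex.conj_im]
  nlinarith [mul_pos hw hz]

theorem image_cayley {w : ℂ} (hw : 0 < w.im) : cayley w '' upperHalf = Metric.ball 0 1 := by
  ext ζ
  rw [mem_ball_zero_iff]
  constructor
  · rintro ⟨z, hz, rfl⟩
    exact norm_cayley_lt hw hz
  · exact fun h => ⟨cayleyInv w ζ, im_cayleyInv_pos hw h, cayley_cayleyInv hw h⟩

/-- The reproducing property of the Bergman kernel of the upper half-plane. -/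
theorem setIntegral_bergmanKernel_mul {g : ℂ → ℂ} {w : ℂ} (hw : 0 < w.im)
    (hg : DifferentiableOn ℂ g upperHalf)
    (hi : IntegrableOn (fun z => (starRingEnd ℂ) (1 / (z - (starRingEnd ℂ) w) ^ 2) * g z)
      upperHalf) :
    ∫ z in upperHalf, (starRingEnd ℂ) (1 / (z - (starRingEnd ℂ) w) ^ 2) * g z =
      -(Real.pi : ℂ) * g w := by
  set v := w - (starRingEnd ℂ) w with hv
  have hv0 : v ≠ 0 := sub_conj_ne_zero hw hw
  have hcv : (starRingEnd ℂ) v = -v := by simp [hv]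
  -- At ζ = `cayley w z` one has 1 - ζ = v / (z - w̄), so the weight is (z - w̄)²/v. It cancels the
  -- holomorphic factor of the Jacobian |v / (z - w̄)²|² and leaves the conjugate factor, which is
  -- the conjugated kernel times -v. The claim is then the mean value property of h at 0.
  set h : ℂ → ℂ := fun ζ => g (cayleyInv w ζ) * (v / (1 - ζ) ^ 2) with hh
  have hd : ∀ ζ ∈ Metric.ball (0 : ℂ) 1, ‖ζ‖ < 1 := fun ζ hζ => mem_ball_zero_iff.1 hζ
  have hdiff : DifferentiableOn ℂ h (Metric.ball 0 1) := by
    refine DifferentiableOn.mul (hg.comp ?_ fun ζ hζ => im_cayleyInv_pos hw (hd ζ hζ)) ?_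
    · unfold cayleyInv
      exact DifferentiableOn.div (by fun_prop) (by fun_prop)
        fun ζ hζ => one_sub_ne_zero_of_norm_lt (hd ζ hζ)
    · exact DifferentiableOn.div (by fun_prop) (by fun_prop)
        fun ζ hζ => pow_ne_zero 2 (one_sub_ne_zero_of_norm_lt (hd ζ hζ))
  have hder : ∀ z ∈ upperHalf, HasFDerivWithinAt (cayley w)
      ((ContinuousLinearMap.toSpanSingleton ℂ (v / (z - (starRingEnd ℂ) w) ^ 2)).restrictScalars ℝ)
      upperHalf z := fun z hz =>
    ((hasDerivAt_cayley hw hz).hasFDerivAt.restrictScalars ℝ).hasFDerivWithinAt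
  have hinj : InjOn (cayley w) upperHalf := fun z hz z' hz' e => by
    rw [← cayleyInv_cayley hw hz, e, cayleyInv_cayley hw hz']
  have hpt : ∀ z ∈ upperHalf,
      |((ContinuousLinearMap.toSpanSingleton ℂ
        (v / (z - (starRingEnd ℂ) w) ^ 2)).restrictScalars ℝ).det| • h (cayley w z) =
      -v * ((starRingEnd ℂ) (1 / (z - (starRingEnd ℂ) w) ^ 2) * g z) := by
    intro z hz
    have hz' : 0 < z.im := hz
    have hzw := sub_conj_ne_zero hz' hw
    have e : 1 - cayley w z = v / (z - (starRingEnd ℂ) w) := by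
      rw [cayley, hv]; field_simp; ring
    rw [abs_det_restrictScalars_toSpanSingleton, hh]
    simp only
    rw [cayleyInv_cayley hw hz', e, Complex.real_smul, Complex.ofReal_pow, ← Complex.conj_mul',
      map_div₀, map_div₀, map_one, hcv]
    field_simp
  have hS : MeasurableSet upperHalf := isOpen_upperHalf.measurableSet
  have hih : IntegrableOn h (Metric.ball 0 1) := by
    rw [← image_cayley hw,
      integrableOn_image_iff_integrableOn_abs_det_fderiv_smul volume hS hder hinj]
    exact IntegrableOn.congr_fun (Integrable.const_mul hi (-v)) (fun z hz => (hpt z hz).symm) hS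
  have key := setIntegral_ball_eq_of_differentiableOn one_pos hdiff hih
  rw [← image_cayley hw, integral_image_eq_integral_abs_det_fderiv_smul volume hS hder hinj,
    setIntegral_congr_fun hS hpt, integral_const_mul] at key
  have h0 : h 0 = g w * v := by simp [hh, cayleyInv]
  rw [h0] at key
  have : -v * (∫ z in upperHalf, (starRingEnd ℂ) (1 / (z - (starRingEnd ℂ) w) ^ 2) * g z) =
      -v * (-(Real.pi : ℂ) * g w) := by
    rw [key]; push_cast; ring
  exact mul_left_cancel₀ (neg_ne_zero.2 hv0) this

/-! ### Unitarity of R₁ on the Bergman space -/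

/-- Shows that the kernel is holomorphic in z, which its definition by real and imaginary parts
hides. -/
theorem bargmannKernel_eq (z : ℂ) (t : ℝ) :
    bargmannKernel z t = (Real.sqrt (2 * t) : ℂ) * Complex.exp (I * z * t) := by
  rw [bargmannKernel, laguerreZero, Complex.ofReal_mul, mul_left_comm, Complex.ofReal_exp,
    ← Complex.exp_add]
  congr 2
  nth_rewrite 3 [← Complex.re_add_im z]
  push_cast
  linear_combination ((t : ℂ) * z.im) * (Complex.I_mul_I).symm

theorem differentiableOn_bargmannInv (f : L2Pos) :
    DifferentiableOn ℂ (bargmannInv f) upperHalf := by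
  intro z₀ hz₀
  have hy : 0 < z₀.im := hz₀
  refine DifferentiableAt.differentiableWithinAt ?_
  have hd : DifferentiableAt ℂ (fun z => ∫ t in Ioi (0 : ℝ), bargmannKernel z t * f t) z₀ := by
    -- On the neighbourhood Im z > 2y, t e^{-t Im z} ≤ t e^{-2ty} ≤ y⁻¹ e^{-ty}: half of the decay
    -- absorbs the factor t produced by differentiation, and the other half is the kernel at iy,
    -- already known to be integrable against f.
    set y := z₀.im / 4 with hydef
    have hy' : 0 < (y * I : ℂ).im := by simp [hydef]; linarith
    have hS : {z : ℂ | 2 * y < z.im} ∈ 𝓝 z₀ :=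
      (isOpen_lt continuous_const Complex.continuous_im).mem_nhds (by
        simp only [mem_ofPred_eq]; linarith)
    have hF : ∀ᶠ z in 𝓝 z₀, IntegrableOn (fun t => bargmannKernel z t * f t) (Ioi 0) := by
      filter_upwards [isOpen_upperHalf.mem_nhds hz₀] with z hz using integrable_bargmann f hz
    have hder := hasDerivAt_integral_of_dominated_loc_of_deriv_le (μ := volume.restrict (Ioi 0))
      (F := fun z t => bargmannKernel z t * f t)
      (F' := fun z t => I * t * (bargmannKernel z t * f t))
      (bound := fun t => y⁻¹ * ‖bargmannKernel (y * I) t * f t‖) hS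
      (hF.mono fun z h => h.aestronglyMeasurable) (integrable_bargmann f hz₀)
      ((by fun_prop : Measurable fun t : ℝ => I * (t : ℂ)).aestronglyMeasurable.mul
        (integrable_bargmann f hz₀).aestronglyMeasurable) ?_
      ((integrable_bargmann f hy').norm.const_mul _) ?_
    · exact hder.2.differentiableAt
    · filter_upwards [ae_restrict_mem measurableSet_Ioi] with t ht z hz
      have ht' : (0 : ℝ) < t := ht
      have hz' : 2 * y < z.im := hz
      have hy0 : 0 < y := by simpa using hy'
      rw [norm_mul, norm_mul, norm_mul, norm_mul, norm_bargmannKernel, norm_bargmannKernel,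
        Complex.norm_I, one_mul, Complex.norm_real, Real.norm_of_nonneg ht'.le]
      have him : (y * I : ℂ).im = y := by simp
      rw [him]
      have key : t * Real.exp (-(t * z.im)) ≤ y⁻¹ * Real.exp (-(t * y)) := by
        have e1 : Real.exp (-(t * z.im)) ≤ Real.exp (-(t * y)) * Real.exp (-(t * y)) := by
          rw [← Real.exp_add]
          apply Real.exp_le_exp.2
          nlinarith
        have e2 : t * Real.exp (-(t * y)) ≤ y⁻¹ := by
          have e := Real.add_one_le_exp (t * y)
          rw [Real.exp_neg, ← div_eq_mul_inv, div_le_iff₀ (Real.exp_pos _), ← div_eq_inv_mul,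
            le_div_iff₀ hy0]
          linarith
        calc t * Real.exp (-(t * z.im)) ≤ t * (Real.exp (-(t * y)) * Real.exp (-(t * y))) := by gcongr
          _ = t * Real.exp (-(t * y)) * Real.exp (-(t * y)) := by ring
          _ ≤ _ := by gcongr
      calc t * (Real.sqrt (2 * t) * Real.exp (-(t * z.im)) * ‖f t‖)
          = (t * Real.exp (-(t * z.im))) * (Real.sqrt (2 * t) * ‖f t‖) := by ring
        _ ≤ (y⁻¹ * Real.exp (-(t * y))) * (Real.sqrt (2 * t) * ‖f t‖) := by gcongr
        _ = _ := by ring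
    · refine Eventually.of_forall fun t z _ => ?_
      simp only [bargmannKernel_eq]
      have h := ((((hasDerivAt_id z).const_mul I).mul_const (t : ℂ)).cexp.const_mul
        (Real.sqrt (2 * t) : ℂ)).mul_const (f t)
      refine h.congr_deriv ?_
      simp only [id]
      ring
  exact hd.const_mul _

theorem bargmannAdj_mem_bergman (f : L2Pos) : bargmannAdj f ∈ bergman :=
  ⟨bargmannInv f, differentiableOn_bargmannInv f, (memLp_bargmannInv f).coeFn_toLp⟩

theorem integral_mul_cexp_neg_mul_Ioi {r : ℂ} (hr : 0 < r.re) :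
    ∫ t in Ioi (0 : ℝ), (t : ℂ) * Complex.exp (-r * t) = 1 / r ^ 2 := by
  have hr0 : r ≠ 0 := fun h => by simp [h] at hr
  have hn : ∀ t : ℝ, ‖Complex.exp (-r * t)‖ = Real.exp (-r.re * t) := by
    intro t
    rw [Complex.norm_exp]
    simp
  have hder : ∀ t ∈ Ici (0 : ℝ), HasDerivAt
      (fun t : ℝ => -((t : ℂ) / r + 1 / r ^ 2) * Complex.exp (-r * t))
      ((t : ℂ) * Complex.exp (-r * t)) t := by
    intro t _
    have h1 := (((hasDerivAt_id t).ofReal_comp.div_const r).add_const (1 / r ^ 2)).neg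
    have h2 := ((hasDerivAt_id t).ofReal_comp.const_mul (-r)).cexp
    refine (h1.mul h2).congr_deriv ?_
    simp only [id, Complex.ofReal_one, Pi.neg_apply]
    field_simp
    ring
  have hint : IntegrableOn (fun t : ℝ => (t : ℂ) * Complex.exp (-r * t)) (Ioi 0) := by
    have h : IntegrableOn (fun t : ℝ => t ^ (1 : ℝ) * Real.exp (-r.re * t ^ (1 : ℝ))) (Ioi 0) :=
      integrableOn_rpow_mul_exp_neg_mul_rpow (by norm_num) (by norm_num) hr
    refine Integrable.mono' h (by fun_prop) ?_
    filter_upwards [ae_restrict_mem measurableSet_Ioi] with t ht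
    have ht' : (0 : ℝ) < t := ht
    rw [norm_mul, hn, Complex.norm_real, Real.norm_of_nonneg ht'.le, Real.rpow_one]
  have hlim : Tendsto (fun t : ℝ => -((t : ℂ) / r + 1 / r ^ 2) * Complex.exp (-r * t)) atTop
      (𝓝 0) := by
    have h1 : Tendsto (fun t : ℝ => (t : ℂ) * Complex.exp (-r * t)) atTop (𝓝 0) := by
      rw [tendsto_zero_iff_norm_tendsto_zero]
      refine (tendsto_rpow_mul_exp_neg_mul_atTop_nhds_zero 1 r.re hr).congr' ?_
      filter_upwards [eventually_ge_atTop 0] with t ht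
      rw [norm_mul, hn, Complex.norm_real, Real.norm_of_nonneg ht, Real.rpow_one]
    have h2 : Tendsto (fun t : ℝ => Complex.exp (-r * t)) atTop (𝓝 0) := by
      rw [tendsto_zero_iff_norm_tendsto_zero]
      refine (tendsto_rpow_mul_exp_neg_mul_atTop_nhds_zero 0 r.re hr).congr fun t => ?_
      rw [hn, Real.rpow_zero, one_mul]
    have h3 := (h1.const_mul (-(1 / r))).add (h2.const_mul (-(1 / r ^ 2)))
    simp only [mul_zero, add_zero] at h3
    refine h3.congr fun t => ?_
    ring
  rw [integral_Ioi_of_hasDerivAt_of_tendsto' hder hint hlim]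
  simp

/-- The function in `L₂(ℝ₊)` whose image is a multiple of the Bergman kernel at `w`. -/
def kernelPreimage {w : ℂ} (hw : 0 < w.im) : L2Pos := (memLp_bargmannKernel hw).star.toLp _

/-- The two factors √(2t) give 2t and the exponentials combine to e^{-rt} with r = -i(z - w̄), whose
real part is Im z + Im w > 0. The Laplace integral of t is 1/r² = -1/(z - w̄)². -/
theorem bargmannInv_kernelPreimage {w z : ℂ} (hw : 0 < w.im) (hz : 0 < z.im) :
    bargmannInv (kernelPreimage hw) z =
      (-2 * ((Real.sqrt (2 * Real.pi))⁻¹ : ℝ) : ℂ) * (1 / (z - (starRingEnd ℂ) w) ^ 2) := by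
  have hne := sub_conj_ne_zero hz hw
  set r : ℂ := -(I * (z - (starRingEnd ℂ) w)) with hr
  have hre : 0 < r.re := by
    simp [hr]; linarith
  have e : ∫ t in Ioi (0 : ℝ), bargmannKernel z t * (kernelPreimage hw) t =
      ∫ t in Ioi (0 : ℝ), 2 * ((t : ℂ) * Complex.exp (-r * t)) := by
    apply integral_congr_ae
    filter_upwards [ae_restrict_mem measurableSet_Ioi,
      (memLp_bargmannKernel hw).star.coeFn_toLp] with t ht h
    have ht' : (0 : ℝ) < t := ht
    rw [kernelPreimage, h, Pi.star_apply, bargmannKernel_eq, bargmannKernel_eq, RCLike.star_def,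
      map_mul, ← Complex.exp_conj, Complex.conj_ofReal]
    have hs : (Real.sqrt (2 * t) : ℂ) * (Real.sqrt (2 * t) : ℂ) = 2 * t := by
      rw [← Complex.ofReal_mul, Real.mul_self_sqrt (by linarith)]; push_cast; rfl
    have hx : Complex.exp (-r * t) = Complex.exp (I * z * t) *
        Complex.exp ((starRingEnd ℂ) (I * w * t)) := by
      rw [← Complex.exp_add]
      congr 1
      simp [hr]
      ring
    rw [hx]
    linear_combination (Complex.exp (I * z * t) * Complex.exp ((starRingEnd ℂ) (I * w * t))) * hs
  have hr2 : 1 / r ^ 2 = -(1 / (z - (starRingEnd ℂ) w) ^ 2) := by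
    rw [hr, neg_sq, mul_pow, Complex.I_sq]
    field_simp
  rw [bargmannInv, e, integral_const_mul, integral_mul_cexp_neg_mul_Ioi hre, hr2]
  ring

/-- Orthogonality to the multiple of the Bergman kernel at w, which lies in the range, forces G w =
0 by the reproducing property. This is the surjectivity of R₁^* onto the Bergman space. -/
theorem eq_zero_of_orthogonal_range {g : L2Plane} (hg : g ∈ bergman)
    (h : ∀ f : L2Pos, inner ℂ (bargmannAdj f) g = 0) : g = 0 := by
  obtain ⟨G, hG, hgG⟩ := hg
  have hzero : ∀ w ∈ upperHalf, G w = 0 := by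
    intro w hw
    have hw' : 0 < w.im := hw
    set c : ℂ := (-2 * ((Real.sqrt (2 * Real.pi))⁻¹ : ℝ) : ℂ) with hc
    have hc0 : (starRingEnd ℂ) c ≠ 0 := by
      rw [Ne, map_eq_zero]
      have : (Real.sqrt (2 * Real.pi))⁻¹ ≠ 0 := by positivity
      simpa [hc] using this
    have hae : (fun z => inner ℂ ((bargmannAdj (kernelPreimage hw') : L2Plane) z) (g z))
        =ᵐ[volume.restrict upperHalf] fun z => (starRingEnd ℂ) c *
          ((starRingEnd ℂ) (1 / (z - (starRingEnd ℂ) w) ^ 2) * G z) := by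
      have h1 : bargmannAdj (kernelPreimage hw') =ᵐ[volume.restrict upperHalf]
        bargmannInv (kernelPreimage hw') := (memLp_bargmannInv _).coeFn_toLp
      filter_upwards [h1, hgG, ae_restrict_mem isOpen_upperHalf.measurableSet] with z e1 e2 hz
      rw [e1, e2, bargmannInv_kernelPreimage hw' hz, RCLike.inner_apply, ← hc, map_mul]
      ring
    have hi : IntegrableOn (fun z => (starRingEnd ℂ) (1 / (z - (starRingEnd ℂ) w) ^ 2) * G z)
        upperHalf := by
      have := (L2.integrable_inner (𝕜 := ℂ) (bargmannAdj (kernelPreimage hw')) g).congr hae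
      exact (integrable_const_mul_iff (isUnit_iff_ne_zero.2 hc0) _).1 this
    have h2 := h (kernelPreimage hw')
    rw [L2.inner_def, integral_congr_ae hae, integral_const_mul,
      setIntegral_bergmanKernel_mul hw' hG hi] at h2
    have hpi : (Real.pi : ℂ) ≠ 0 := by exact_mod_cast Real.pi_ne_zero
    simpa [hc0, hpi] using h2
  rw [Lp.eq_zero_iff_ae_eq_zero]
  filter_upwards [hgG, ae_restrict_mem isOpen_upperHalf.measurableSet] with z e hz
  rw [e, hzero z hz, Pi.zero_apply]

theorem adjoint_bergmanIncl : ContinuousLinearMap.adjoint bergmanIncl = bergmanProj :=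
  bergman.adjoint_subtypeL

theorem bergmanIncl_adjoint_bargmann (f : L2Pos) :
    bergmanIncl (ContinuousLinearMap.adjoint bargmann f) = bargmannAdj f := by
  rw [bargmann, ContinuousLinearMap.adjoint_comp, ContinuousLinearMap.adjoint_adjoint,
    adjoint_bergmanIncl]
  exact Submodule.starProjection_eq_self_iff.2 (bargmannAdj_mem_bergman f)

theorem bargmann_comp_adjoint : bargmann ∘L ContinuousLinearMap.adjoint bargmann = 1 := by
  ext1 f
  rw [ContinuousLinearMap.comp_apply]
  nth_rewrite 1 [bargmann]
  rw [ContinuousLinearMap.comp_apply, bergmanIncl_adjoint_bargmann]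
  exact congrArg (fun T : L2Pos →L[ℂ] L2Pos => T f) (LinearIsometry.adjoint_comp_self bargmannAdj)

theorem injective_bargmann : Function.Injective bargmann := by
  rw [injective_iff_map_eq_zero]
  intro g hg
  have h : bergmanIncl g = 0 := by
    refine eq_zero_of_orthogonal_range (Subtype.property (p := (· ∈ bergman)) g) fun f => ?_
    have : inner ℂ f (bargmann g) = inner ℂ (bargmannAdj f) (bergmanIncl g) :=
      ContinuousLinearMap.adjoint_inner_right bargmannAdj.toContinuousLinearMap f (bergmanIncl g)
    rw [← this, hg, inner_zero_right]
  exact Subtype.ext h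

/-- An injective coisometry is unitary: R₁ R₁^* R₁ = R₁, and R₁ on the left cancels. -/
theorem adjoint_comp_bargmann : ContinuousLinearMap.adjoint bargmann ∘L bargmann = 1 := by
  ext1 g
  apply injective_bargmann
  exact congrArg (fun T : L2Pos →L[ℂ] L2Pos => T (bargmann g)) bargmann_comp_adjoint

/-! ### Multiplication by C[0,∞] as a faithful representation on L₂(ℝ₊) -/

theorem coeFn_mulLp {α : Type*} [MeasurableSpace α] {μ : Measure α} (a : Lp ℂ ∞ μ) (f : Lp ℂ 2 μ) :
    mulLp a f =ᵐ[μ] fun x => a x * f x :=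
  ContinuousLinearMap.coeFn_holder (r := 2) (ContinuousLinearMap.mul ℂ ℂ) a f

/-- The restriction of a continuous function on `[0, ∞]` to `ℝ₊` as an element of `L_∞(ℝ₊)`. -/
def restrictLp (f : C(ℝ≥0∞, ℂ)) : Lp ℂ ∞ (volume.restrict (Ioi (0 : ℝ))) :=
  MemLp.toLp (fun x : ℝ => f (ENNReal.ofReal x)) <|
    memLp_top_of_bound (C := ‖f‖)
      (f.continuous.comp ENNReal.continuous_ofReal).aestronglyMeasurable
      (Eventually.of_forall fun x => f.norm_coe_le_norm (ENNReal.ofReal x))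

theorem coeFn_mulLp_restrictLp (f : C(ℝ≥0∞, ℂ)) (h : L2Pos) :
    mulLp (restrictLp f) h =ᵐ[volume.restrict (Ioi (0 : ℝ))]
      fun x => f (ENNReal.ofReal x) * h x := by
  have h1 : restrictLp f =ᵐ[volume.restrict (Ioi (0 : ℝ))] fun x => f (ENNReal.ofReal x) :=
    MemLp.coeFn_toLp _
  filter_upwards [coeFn_mulLp (restrictLp f) h, h1] with x e1 e2
  rw [e1, e2]

/-- Multiplication by the restrictions of continuous functions on `[0, ∞]`, as a representation
on `L₂(ℝ₊)`. -/
def mulFun : C(ℝ≥0∞, ℂ) →⋆ₐ[ℂ] (L2Pos →L[ℂ] L2Pos) where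
  toFun f := mulLp (restrictLp f)
  map_one' := by
    ext1 h
    apply Lp.ext
    filter_upwards [coeFn_mulLp_restrictLp 1 h] with x e
    rw [e]; simp
  map_mul' f g := by
    ext1 h
    apply Lp.ext
    filter_upwards [coeFn_mulLp_restrictLp (f * g) h,
      coeFn_mulLp_restrictLp f (mulLp (restrictLp g) h), coeFn_mulLp_restrictLp g h] with x e1 e2 e3
    rw [e1, mul_apply_eq_comp, e2, e3, ContinuousMap.mul_apply, mul_assoc]
  map_zero' := by
    ext1 h
    apply Lp.ext
    filter_upwards [coeFn_mulLp_restrictLp 0 h, Lp.coeFn_zero ℂ 2 (volume.restrict (Ioi (0 : ℝ)))]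
      with x e e'
    exact e.trans ((zero_mul _).trans e'.symm)
  map_add' f g := by
    ext1 h
    apply Lp.ext
    filter_upwards [coeFn_mulLp_restrictLp (f + g) h, coeFn_mulLp_restrictLp f h,
      coeFn_mulLp_restrictLp g h,
      Lp.coeFn_add (mulLp (restrictLp f) h) (mulLp (restrictLp g) h)] with x e1 e2 e3 e4
    refine (e1.trans ?_).trans e4.symm
    rw [Pi.add_apply, e2, e3, ContinuousMap.add_apply, add_mul]
  commutes' c := by
    ext1 h
    apply Lp.ext
    filter_upwards [coeFn_mulLp_restrictLp (algebraMap ℂ _ c) h, Lp.coeFn_smul c h] with x e1 e2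
    refine (e1.trans ?_).trans e2.symm
    simp [Algebra.algebraMap_eq_smul_one]
  map_star' f := by
    rw [ContinuousLinearMap.star_eq_adjoint, ContinuousLinearMap.eq_adjoint_iff]
    intro g h
    rw [L2.inner_def, L2.inner_def]
    apply integral_congr_ae
    filter_upwards [coeFn_mulLp_restrictLp (star f) g, coeFn_mulLp_restrictLp f h] with x e1 e2
    rw [e1, e2]
    simp [RCLike.inner_apply]
    ring

theorem coeFn_mulFun (f : C(ℝ≥0∞, ℂ)) (h : L2Pos) :
    mulFun f h =ᵐ[volume.restrict (Ioi (0 : ℝ))] fun x => f (ENNReal.ofReal x) * h x :=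
  coeFn_mulLp_restrictLp f h

theorem dense_ofReal_image_Ioi : Dense (ENNReal.ofReal '' Ioi 0) := by
  have h : ENNReal.ofReal '' Ioi 0 = ({0, ∞} : Set ℝ≥0∞)ᶜ := by
    ext t
    constructor
    · rintro ⟨x, hx, rfl⟩
      have : (0 : ℝ) < x := hx
      simp [this]
    · intro ht
      simp only [mem_compl_iff, mem_insert_iff, mem_singleton_iff, not_or] at ht
      exact ⟨t.toReal, ENNReal.toReal_pos ht.1 ht.2, ENNReal.ofReal_toReal ht.2⟩
  rw [h]
  rw [compl_eq_univ_sdiff]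
  exact dense_univ.sdiff_finite (Set.toFinite _)

theorem exists_L2Pos_ne_zero : ∃ h : L2Pos, ∀ᵐ x ∂(volume.restrict (Ioi (0 : ℝ))), h x ≠ 0 := by
  have hI : (0 : ℝ) < (I : ℂ).im := by simp
  refine ⟨(memLp_bargmannKernel hI).toLp _, ?_⟩
  filter_upwards [(memLp_bargmannKernel hI).coeFn_toLp, ae_restrict_mem measurableSet_Ioi]
    with x e hx
  have hx' : (0 : ℝ) < x := hx
  rw [e, ← norm_pos_iff, norm_bargmannKernel]
  positivity

/-- Tested on an almost everywhere nonzero h, a zero multiplier vanishes almost everywhere, hence on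
all of (0,∞) by continuity, hence at 0 and ∞ by density. -/
theorem injective_mulFun : Function.Injective mulFun := by
  rw [injective_iff_map_eq_zero]
  intro f hf
  obtain ⟨h, hh⟩ := exists_L2Pos_ne_zero
  have hae : (fun x => f (ENNReal.ofReal x)) =ᵐ[volume.restrict (Ioi (0 : ℝ))] fun _ => 0 := by
    have e := coeFn_mulFun f h
    rw [hf, zero_apply] at e
    filter_upwards [e, hh, Lp.coeFn_zero ℂ 2 (volume.restrict (Ioi (0 : ℝ)))] with x e1 e2 e3
    rw [e3, Pi.zero_apply] at e1
    exact (mul_eq_zero.1 e1.symm).resolve_right e2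
  have hon := Measure.eqOn_open_of_ae_eq hae isOpen_Ioi
    (f.continuous.comp ENNReal.continuous_ofReal).continuousOn continuousOn_const
  have hz : EqOn f 0 (ENNReal.ofReal '' Ioi 0) := by
    rintro _ ⟨x, hx, rfl⟩
    exact hon hx
  ext1 t
  exact congrFun (Continuous.ext_on dense_ofReal_image_Ioi f.continuous continuous_const hz) t

/-! ### Diagonalisation of the Toeplitz operators and their square roots -/

theorem verticalSymbol_nonneg (n : ℕ) (j : Fin n) (y : ℝ) : 0 ≤ verticalSymbol n j y := by
  unfold verticalSymbol
  split_ifs <;> exact Set.indicator_nonneg (fun _ _ => zero_le_one) _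

/-- The substitution y ↦ 2ty in the integral defining γ^{a_j}(t). -/
theorem lintegral_verticalSymbol (n : ℕ) (j : Fin n) {t : ℝ} (ht : 0 < t) :
    ∫⁻ y in Ioi (0 : ℝ), ENNReal.ofReal (verticalSymbol n j y) *
      ENNReal.ofReal (2 * t * Real.exp (-(2 * t * y))) = ENNReal.ofReal (gammaFun n j t) := by
  have hi : IntegrableOn (fun y => verticalSymbol n j y * (2 * t * Real.exp (-(2 * t * y))))
      (Ioi 0) := by
    have h : IntegrableOn (fun y => Real.exp (-(2 * t) * y)) (Ioi 0) :=
      exp_neg_integrableOn_Ioi 0 (by linarith)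
    refine Integrable.bdd_mul (c := 1) ?_ (measurable_verticalSymbol n j).aestronglyMeasurable
      (Eventually.of_forall (norm_verticalSymbol_le n j))
    refine (h.const_mul (2 * t)).congr (Eventually.of_forall fun y => ?_)
    simp only [neg_mul]
  have hv : ∫ y in Ioi (0 : ℝ), verticalSymbol n j y * (2 * t * Real.exp (-(2 * t * y))) =
      gammaFun n j t := by
    have h := integral_comp_mul_left_Ioi
      (fun y => verticalSymbol n j (y / (2 * |t|)) * laguerreZero y ^ 2) 0
      (by positivity : (0 : ℝ) < 2 * t)
    rw [mul_zero] at h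
    rw [gammaFun, ← smul_inv_smul₀ (by positivity : (2 * t : ℝ) ≠ 0)
      (∫ y in Ioi (0 : ℝ), verticalSymbol n j (y / (2 * |t|)) * laguerreZero y ^ 2), ← h,
      ← integral_smul]
    congr 1
    ext y
    rw [abs_of_pos ht, mul_div_cancel_left₀ _ (by positivity), laguerreZero_sq, smul_eq_mul]
    ring
  rw [← hv, ofReal_integral_eq_lintegral_ofReal hi
    (Eventually.of_forall fun y => mul_nonneg (verticalSymbol_nonneg n j y) (by positivity))]
  refine lintegral_congr fun y => ?_
  rw [ENNReal.ofReal_mul (verticalSymbol_nonneg n j y)]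

/-- This computes the quadratic form of T_{a_j}. The symbol is constant on horizontal lines, so
Plancherel applies on each line, and Tonelli then integrates out y for fixed t. -/
theorem lintegral_verticalSymbol_bargmannInv (n : ℕ) (j : Fin n) (f : L2Pos) :
    ∫⁻ z in upperHalf, ENNReal.ofReal (verticalSymbol n j z.im) * ‖bargmannInv f z‖ₑ ^ 2 =
      ∫⁻ t in Ioi (0 : ℝ), ENNReal.ofReal (gammaFun n j t) * ‖f t‖ₑ ^ 2 := by
  have ha : Measurable fun y => ENNReal.ofReal (verticalSymbol n j y) :=
    ENNReal.measurable_ofReal.comp (measurable_verticalSymbol n j)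
  have hm : Measurable fun z : ℂ =>
      ENNReal.ofReal (verticalSymbol n j z.im) * ‖bargmannInv f z‖ₑ ^ 2 :=
    (ha.comp Complex.measurable_im).mul ((measurable_bargmannInv f).measurable.enorm.pow_const 2)
  have hfm := ((Lp.stronglyMeasurable f).measurable.enorm.pow_const 2)
  have e1 : ∫⁻ z in upperHalf, ENNReal.ofReal (verticalSymbol n j z.im) * ‖bargmannInv f z‖ₑ ^ 2 =
      ∫⁻ y in Ioi (0 : ℝ), ∫⁻ x : ℝ,
        ENNReal.ofReal (verticalSymbol n j y) * ‖bargmannInv f (x + y * I)‖ₑ ^ 2 := by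
    rw [← Complex.volume_preserving_equiv_real_prod.symm.setLIntegral_comp_preimage
      isOpen_upperHalf.measurableSet hm]
    have : (Complex.measurableEquivRealProd.symm ⁻¹' upperHalf) = univ ×ˢ Ioi (0 : ℝ) := by
      ext p; simp [Complex.measurableEquivRealProd]
    rw [this, Measure.volume_eq_prod, ← Measure.prod_restrict, Measure.restrict_univ,
      lintegral_prod_symm _ (by
        exact (hm.comp Complex.measurableEquivRealProd.symm.measurable).aemeasurable)]
    refine lintegral_congr fun y => lintegral_congr fun x => ?_
    have : Complex.measurableEquivRealProd.symm (x, y) = x + y * I := by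
      apply Complex.ext <;> simp [Complex.measurableEquivRealProd]
    rw [this]
    simp
  have e2 : ∀ y ∈ Ioi (0 : ℝ), ∫⁻ x : ℝ,
        ENNReal.ofReal (verticalSymbol n j y) * ‖bargmannInv f (x + y * I)‖ₑ ^ 2 =
      ∫⁻ t in Ioi (0 : ℝ), ENNReal.ofReal (verticalSymbol n j y) *
        ENNReal.ofReal (2 * t * Real.exp (-(2 * t * y))) * ‖f t‖ₑ ^ 2 := by
    intro y hy
    rw [lintegral_const_mul' _ _ ENNReal.ofReal_ne_top, lintegral_bargmannInv_line f hy,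
      ← lintegral_const_mul' _ _ ENNReal.ofReal_ne_top]
    simp only [mul_assoc]
  rw [e1, setLIntegral_congr_fun measurableSet_Ioi e2]
  rw [lintegral_lintegral_swap (by
    apply Measurable.aemeasurable
    apply Measurable.mul (Measurable.mul (ha.comp measurable_fst) (by fun_prop))
      (hfm.comp measurable_snd))]
  refine setLIntegral_congr_fun measurableSet_Ioi fun t ht => ?_
  have hm' : Measurable fun y => ENNReal.ofReal (verticalSymbol n j y) *
      ENNReal.ofReal (2 * t * Real.exp (-(2 * t * y))) := ha.mul (by fun_prop)
  rw [lintegral_mul_const _ hm', lintegral_verticalSymbol n j ht]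

/-- `γ^{a_j}` as a complex-valued function. -/
def gammaC (n : ℕ) (j : Fin n) : C(ℝ≥0∞, ℂ) := ⟨fun t => (gamma n j t : ℂ), by fun_prop⟩

theorem sqrtGamma_mul_self (n : ℕ) (j : Fin n) : sqrtGamma n j * sqrtGamma n j = gammaC n j := by
  ext1 t
  change (Real.sqrt (gamma n j t) : ℂ) * (Real.sqrt (gamma n j t) : ℂ) = (gamma n j t : ℂ)
  rw [← Complex.ofReal_mul, Real.mul_self_sqrt (gamma_nonneg n j t)]

theorem gamma_ofReal (n : ℕ) (j : Fin n) {x : ℝ} (hx : 0 < x) :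
    gamma n j (ENNReal.ofReal x) = gammaFun n j x := by
  have h : gamma n j (ENNReal.ofReal x) = gammaFun n j (ENNReal.ofReal x).toReal := by
    simp [gamma, hx]
  rw [h, ENNReal.toReal_ofReal hx.le]

/-- Writes the quadratic form of a nonnegative multiplier as a lower Lebesgue integral, the form in
which Tonelli was applied. -/
theorem inner_mul_eq_lintegral {α : Type*} [MeasurableSpace α] {μ : Measure α} {u v : Lp ℂ 2 μ}
    {b : α → ℝ} (hb : ∀ᵐ x ∂μ, 0 ≤ b x) (hv : v =ᵐ[μ] fun x => (b x : ℂ) * u x) :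
    inner ℂ v u = ((∫⁻ x, ENNReal.ofReal (b x) * ‖u x‖ₑ ^ 2 ∂μ).toReal : ℂ) := by
  have hae : (fun x => inner ℂ (v x) (u x)) =ᵐ[μ] fun x => ((b x * ‖u x‖ ^ 2 : ℝ) : ℂ) := by
    filter_upwards [hv] with x e
    rw [e, RCLike.inner_apply, map_mul, Complex.conj_ofReal, mul_left_comm, Complex.mul_conj']
    push_cast; rfl
  have hi : Integrable (fun x => b x * ‖u x‖ ^ 2) μ := by
    have := ((L2.integrable_inner (𝕜 := ℂ) v u).congr hae).re
    refine this.congr (Eventually.of_forall fun x => ?_)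
    exact Complex.ofReal_re _
  rw [L2.inner_def, integral_congr_ae hae, integral_complex_ofReal,
    integral_eq_lintegral_of_nonneg_ae (by
      filter_upwards [hb] with x hx using mul_nonneg hx (by positivity)) hi.aestronglyMeasurable]
  congr 2
  refine lintegral_congr_ae ?_
  filter_upwards [hb] with x hx
  rw [ENNReal.ofReal_mul hx, ENNReal.ofReal_pow (norm_nonneg _), ofReal_norm]

/-- By polarisation, an operator on a complex Hilbert space is determined by its quadratic form, so
comparing the diagonal inner products suffices. -/
theorem bargmann_toeplitz_adjoint (n : ℕ) (j : Fin n) :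
    bargmann ∘L toeplitz (symbolLp n j) ∘L ContinuousLinearMap.adjoint bargmann =
      mulFun (gammaC n j) := by
  apply ContinuousLinearMap.coe_injective
  rw [← ext_inner_map]
  intro f
  have hsym : symbolLp n j =ᵐ[volume.restrict upperHalf] fun z => (verticalSymbol n j z.im : ℂ) :=
    MemLp.coeFn_toLp _
  have hadj : bargmannAdj f =ᵐ[volume.restrict upperHalf] bargmannInv f :=
    (memLp_bargmannInv f).coeFn_toLp
  have e1 : inner ℂ ((bargmann ∘L toeplitz (symbolLp n j) ∘L
      ContinuousLinearMap.adjoint bargmann) f) f =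
      inner ℂ (mulLp (symbolLp n j) (bargmannAdj f)) (bargmannAdj f) := by
    rw [ContinuousLinearMap.comp_apply, ← ContinuousLinearMap.adjoint_inner_right,
      ContinuousLinearMap.comp_apply, toeplitz, ContinuousLinearMap.comp_apply,
      ContinuousLinearMap.comp_apply, bergmanIncl_adjoint_bargmann, ← adjoint_bergmanIncl,
      ContinuousLinearMap.adjoint_inner_left, bergmanIncl_adjoint_bargmann]
  have e2 := inner_mul_eq_lintegral (u := bargmannAdj f)
    (v := mulLp (symbolLp n j) (bargmannAdj f)) (b := fun z => verticalSymbol n j z.im)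
    (Eventually.of_forall fun z => verticalSymbol_nonneg n j z.im) (by
      filter_upwards [coeFn_mulLp (symbolLp n j) (bargmannAdj f), hsym] with z h1 h2
      rw [h1, h2])
  have e3 := inner_mul_eq_lintegral (u := f) (v := mulFun (gammaC n j) f)
    (b := fun x => gamma n j (ENNReal.ofReal x))
    (Eventually.of_forall fun x => gamma_nonneg n j _) (coeFn_mulFun _ f)
  simp only [ContinuousLinearMap.coe_coe]
  rw [e1, e2, e3]
  congr 2
  calc _ = ∫⁻ z in upperHalf, ENNReal.ofReal (verticalSymbol n j z.im) *
        ‖bargmannInv f z‖ₑ ^ 2 := by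
        refine lintegral_congr_ae ?_
        filter_upwards [hadj] with z h
        rw [h]
    _ = _ := by
        rw [lintegral_verticalSymbol_bargmannInv]
        refine setLIntegral_congr_fun measurableSet_Ioi fun t ht => ?_
        simp only [gamma_ofReal n j ht]

theorem toeplitz_eq (n : ℕ) (j : Fin n) :
    toeplitz (symbolLp n j) =
      ContinuousLinearMap.adjoint bargmann ∘L mulFun (gammaC n j) ∘L bargmann := by
  rw [← bargmann_toeplitz_adjoint]
  ext1 g
  have h := fun g => congrArg (fun T : BergmanSpace →L[ℂ] BergmanSpace => T g) adjoint_comp_bargmann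
  simp only [ContinuousLinearMap.comp_apply] at h ⊢
  rw [h, h]
  rfl

theorem bargmann_adjoint_apply (f : L2Pos) :
    bargmann (ContinuousLinearMap.adjoint bargmann f) = f :=
  congrArg (fun T : L2Pos →L[ℂ] L2Pos => T f) bargmann_comp_adjoint

theorem adjoint_bargmann_apply (g : BergmanSpace) :
    ContinuousLinearMap.adjoint bargmann (bargmann g) = g :=
  congrArg (fun T : BergmanSpace →L[ℂ] BergmanSpace => T g) adjoint_comp_bargmann

theorem mulFun_sqrtGamma_nonneg (n : ℕ) (j : Fin n) : 0 ≤ mulFun (sqrtGamma n j) := by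
  -- The fourth root of γ^{a_j} exhibits √γ^{a_j} as q^* q, and *-homomorphisms preserve such
  -- elements.
  let q : C(ℝ≥0∞, ℂ) := ⟨fun t => (Real.sqrt (Real.sqrt (gamma n j t)) : ℂ), by fun_prop⟩
  have hq : star q * q = sqrtGamma n j := by
    ext1 t
    change (starRingEnd ℂ) (Real.sqrt (Real.sqrt (gamma n j t)) : ℂ) *
      (Real.sqrt (Real.sqrt (gamma n j t)) : ℂ) = (Real.sqrt (gamma n j t) : ℂ)
    rw [Complex.conj_ofReal, ← Complex.ofReal_mul, Real.mul_self_sqrt (Real.sqrt_nonneg _)]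
  rw [← hq, map_mul, map_star]
  exact star_mul_self_nonneg _

/-- Uniqueness of the positive square root: the right side is positive, and its square collapses to
T_{a_j} because R₁ R₁^* = 1. -/
theorem sqrt_toeplitz (n : ℕ) (j : Fin n) :
    CFC.sqrt (toeplitz (symbolLp n j)) =
      ContinuousLinearMap.adjoint bargmann ∘L mulFun (sqrtGamma n j) ∘L bargmann := by
  refine CFC.sqrt_unique ?_ ?_
  · rw [toeplitz_eq, ← sqrtGamma_mul_self, map_mul]
    ext1 g
    simp only [mul_apply_eq_comp, ContinuousLinearMap.comp_apply, bargmann_adjoint_apply]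
  · rw [ContinuousLinearMap.nonneg_iff_isPositive]
    exact ((ContinuousLinearMap.nonneg_iff_isPositive _).1
      (mulFun_sqrtGamma_nonneg n j)).adjoint_conj bargmann

/-! ### Operators given by matrices of operators -/

section BlockOperators

variable {n : ℕ} {H K : Type*} [NormedAddCommGroup H] [InnerProductSpace ℂ H]
  [NormedAddCommGroup K] [InnerProductSpace ℂ K]

theorem blockOp_apply (A : Matrix (Fin n) (Fin n) (H →L[ℂ] K)) (f : PiLp 2 (fun _ : Fin n => H))
    (j : Fin n) : blockOp A f j = ∑ k, A j k (f k) := by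
  simp [blockOp]

theorem blockOp_diagonal_apply (T : H →L[ℂ] K) (f : PiLp 2 (fun _ : Fin n => H)) (j : Fin n) :
    blockOp (Matrix.diagonal fun _ => T) f j = T (f j) := by
  rw [blockOp_apply, Finset.sum_eq_single j]
  · rw [Matrix.diagonal_apply_eq]
  · intro k _ hk
    rw [Matrix.diagonal_apply_ne _ hk.symm, zero_apply]
  · simp

theorem adjoint_blockOp [CompleteSpace H] [CompleteSpace K]
    (A : Matrix (Fin n) (Fin n) (H →L[ℂ] K)) :
    ContinuousLinearMap.adjoint (blockOp A) =
      blockOp (Matrix.of fun j k => ContinuousLinearMap.adjoint (A k j)) := by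
  symm
  rw [ContinuousLinearMap.eq_adjoint_iff]
  intro f g
  simp only [PiLp.inner_apply, blockOp_apply, Matrix.of_apply, sum_inner, inner_sum,
    ContinuousLinearMap.adjoint_inner_left]
  exact Finset.sum_comm

theorem adjoint_blockOp_diagonal_apply [CompleteSpace H] [CompleteSpace K] (T : H →L[ℂ] K)
    (f : PiLp 2 (fun _ : Fin n => K)) (j : Fin n) :
    ContinuousLinearMap.adjoint (blockOp (Matrix.diagonal fun _ => T)) f j =
      ContinuousLinearMap.adjoint T (f j) := by
  rw [adjoint_blockOp, blockOp_apply, Finset.sum_eq_single j]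
  · rw [Matrix.of_apply, Matrix.diagonal_apply_eq]
  · intro k _ hk
    rw [Matrix.of_apply, Matrix.diagonal_apply_ne _ hk, map_zero, zero_apply]
  · simp

end BlockOperators

/-! ### Matrix multipliers as a faithful representation -/

theorem matrixMul_apply {n : ℕ} (M : MatrixFun n) (f : L2PosN n) (j : Fin n) :
    matrixMul M f j = ∑ k, mulFun (entry M j k) (f k) :=
  blockOp_apply _ f j

theorem entry_mul {n : ℕ} (M N : MatrixFun n) (i k : Fin n) :
    entry (M * N) i k = ∑ j, entry M i j * entry N j k := by
  ext1 t
  simp [entry, ContinuousMap.sum_apply, Matrix.mul_apply]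

theorem entry_one {n : ℕ} (i k : Fin n) :
    entry (1 : MatrixFun n) i k = if i = k then 1 else 0 := by
  ext1 t
  change (1 : Matrix (Fin n) (Fin n) ℂ) i k = _
  rw [Matrix.one_apply]
  split_ifs <;> rfl

/-- Multiplication by matrix-valued functions as a representation on `(L₂(ℝ₊))^n`. -/
def matrixMulHom (n : ℕ) : MatrixFun n →⋆ₐ[ℂ] (L2PosN n →L[ℂ] L2PosN n) where
  toFun := matrixMul
  map_one' := by
    ext1 f
    ext1 j
    rw [matrixMul_apply, Finset.sum_eq_single j]
    · simp [entry_one]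
    · intro k _ hk
      simp [entry_one, hk.symm]
    · simp
  map_mul' M N := by
    ext1 f
    ext1 j
    rw [mul_apply_eq_comp, matrixMul_apply, matrixMul_apply]
    simp only [matrixMul_apply, entry_mul, map_sum, map_mul, sum_apply, mul_apply_eq_comp]
    exact Finset.sum_comm
  map_zero' := by
    ext1 f
    ext1 j
    have h : ∀ k, entry (0 : MatrixFun n) j k = 0 := fun k => rfl
    rw [matrixMul_apply]
    simp [h]
  map_add' M N := by
    ext1 f
    ext1 j
    have h : ∀ k, entry (M + N) j k = entry M j k + entry N j k := fun k => rfl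
    rw [add_apply, PiLp.add_apply, matrixMul_apply, matrixMul_apply, matrixMul_apply,
      ← Finset.sum_add_distrib]
    simp only [h, map_add, add_apply]
  commutes' c := by
    ext1 f
    ext1 j
    have h : ∀ k, entry (algebraMap ℂ (MatrixFun n) c) j k = c • entry (1 : MatrixFun n) j k := by
      intro k
      rw [Algebra.algebraMap_eq_smul_one]
      rfl
    rw [matrixMul_apply, Finset.sum_eq_single j]
    · rw [h, entry_one, if_pos rfl, map_smul, map_one, Algebra.algebraMap_eq_smul_one]
      rfl
    · intro k _ hk
      rw [h, entry_one, if_neg hk.symm, smul_zero, map_zero, zero_apply]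
    · simp
  map_star' M := by
    refine Eq.trans ?_ (adjoint_blockOp _).symm
    refine congrArg blockOp (Matrix.ext fun j k => ?_)
    have h : entry (star M) j k = star (entry M k j) := rfl
    change mulFun (entry (star M) j k) = star (mulFun (entry M k j))
    rw [h, map_star]

theorem injective_matrixMulHom (n : ℕ) : Function.Injective (matrixMulHom n) := by
  rw [injective_iff_map_eq_zero]
  intro M hM
  have h : ∀ j k, entry M j k = 0 := by
    intro j k
    apply injective_mulFun
    rw [map_zero]
    ext1 u
    have e := congrArg (fun T : L2PosN n →L[ℂ] L2PosN n => T (PiLp.single 2 k u) j) hM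
    -- A vector supported in the k-th coordinate isolates the k-th column of M.
    change matrixMul M (PiLp.single 2 k u) j = 0 at e
    rw [matrixMul_apply, Finset.sum_eq_single k] at e
    · simpa using e
    · intro i _ hi
      simp [hi]
    · simp
  ext1 t
  ext j k
  exact congrArg (fun f : C(ℝ≥0∞, ℂ) => f t) (h j k)

/-! ### Conjugation by R -/

theorem bargmannN_comp_adjoint (n : ℕ) :
    bargmannN n ∘L ContinuousLinearMap.adjoint (bargmannN n) = 1 := by
  ext1 f
  ext1 j
  rw [ContinuousLinearMap.comp_apply, bargmannN, blockOp_diagonal_apply,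
    adjoint_blockOp_diagonal_apply, bargmann_adjoint_apply]
  rfl

theorem adjoint_comp_bargmannN (n : ℕ) :
    ContinuousLinearMap.adjoint (bargmannN n) ∘L bargmannN n = 1 := by
  ext1 f
  ext1 j
  rw [ContinuousLinearMap.comp_apply, bargmannN, adjoint_blockOp_diagonal_apply,
    blockOp_diagonal_apply, adjoint_bargmann_apply]
  rfl

theorem bargmannN_adjoint_apply {n : ℕ} (f : L2PosN n) :
    bargmannN n (ContinuousLinearMap.adjoint (bargmannN n) f) = f :=
  congrArg (fun T : L2PosN n →L[ℂ] L2PosN n => T f) (bargmannN_comp_adjoint n)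

theorem adjoint_bargmannN_apply {n : ℕ} (g : BergmanN n) :
    ContinuousLinearMap.adjoint (bargmannN n) (bargmannN n g) = g :=
  congrArg (fun T : BergmanN n →L[ℂ] BergmanN n => T g) (adjoint_comp_bargmannN n)

/-- The representation `M ↦ R^* M R` of matrix-valued functions on `(A²(Π))^n`. -/
def bergmanRep (n : ℕ) : MatrixFun n →⋆ₐ[ℂ] (BergmanN n →L[ℂ] BergmanN n) where
  toFun M := ContinuousLinearMap.adjoint (bargmannN n) ∘L matrixMulHom n M ∘L bargmannN n
  map_one' := by
    ext1 f
    rw [map_one]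
    exact adjoint_bargmannN_apply f
  map_mul' M N := by
    ext1 f
    simp only [map_mul, mul_apply_eq_comp, ContinuousLinearMap.comp_apply, bargmannN_adjoint_apply]
  map_zero' := by
    ext1 f
    simp only [map_zero, ContinuousLinearMap.comp_apply, zero_apply]
  map_add' M N := by
    ext1 f
    simp only [map_add, ContinuousLinearMap.comp_apply, add_apply]
  commutes' c := by
    ext1 f
    simp only [Algebra.algebraMap_eq_smul_one, map_smul, map_one, ContinuousLinearMap.comp_apply,
      smul_apply, one_apply_eq_self, adjoint_bargmannN_apply]
  map_star' M := by
    rw [map_star, ContinuousLinearMap.star_eq_adjoint, ContinuousLinearMap.star_eq_adjoint,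
      ContinuousLinearMap.adjoint_comp, ContinuousLinearMap.adjoint_comp,
      ContinuousLinearMap.adjoint_adjoint]
    rfl

theorem bargmannN_bergmanRep {n : ℕ} (M : MatrixFun n) :
    bargmannN n ∘L bergmanRep n M ∘L ContinuousLinearMap.adjoint (bargmannN n) = matrixMul M := by
  ext1 f
  change bargmannN n (ContinuousLinearMap.adjoint (bargmannN n) (matrixMul M (bargmannN n
    (ContinuousLinearMap.adjoint (bargmannN n) f)))) = _
  rw [bargmannN_adjoint_apply, bargmannN_adjoint_apply]

theorem injective_bergmanRep (n : ℕ) : Function.Injective (bergmanRep n) := by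
  intro M N h
  apply injective_matrixMulHom n
  change matrixMul M = matrixMul N
  rw [← bargmannN_bergmanRep, ← bargmannN_bergmanRep, h]

/-- An injective *-homomorphism between C*-algebras is automatically isometric; no norm of a
multiplication operator is computed. -/
theorem isometry_bergmanRep (n : ℕ) : Isometry (bergmanRep n) :=
  NonUnitalStarAlgHom.isometry (bergmanRep n) (injective_bergmanRep n)

theorem bergmanRep_apply {n : ℕ} (M : MatrixFun n) (f : BergmanN n) (j : Fin n) :
    bergmanRep n M f j =
      ∑ k, ContinuousLinearMap.adjoint bargmann (mulFun (entry M j k) (bargmann (f k))) := by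
  change ContinuousLinearMap.adjoint (bargmannN n) (matrixMul M (bargmannN n f)) j = _
  rw [bargmannN, adjoint_blockOp_diagonal_apply, matrixMul_apply, map_sum]
  simp only [blockOp_diagonal_apply]

theorem bergmanRep_projGamma (n : ℕ) : bergmanRep n (projGamma n) = projT n := by
  ext1 f
  ext1 j
  rw [bergmanRep_apply]
  refine Eq.trans ?_ (blockOp_apply _ f j).symm
  refine Finset.sum_congr rfl fun k _ => ?_
  have h : entry (projGamma n) j k = sqrtGamma n j * sqrtGamma n k := by
    ext1 t
    exact Complex.ofReal_mul _ _
  simp only [sqrt_toeplitz, mul_apply_eq_comp, ContinuousLinearMap.comp_apply, h, map_mul,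
    bargmann_adjoint_apply]

theorem bergmanRep_projConst (n : ℕ) (i : Fin n) :
    bergmanRep n (projConst n i) = coordProj n i := by
  ext1 f
  ext1 j
  rw [bergmanRep_apply, coordProj, blockOp_apply]
  refine Finset.sum_congr rfl fun k _ => ?_
  have h : entry (projConst n i) j k = if i = j ∧ i = k then 1 else 0 := by
    ext1 t
    change Matrix.single i i (1 : ℂ) j k = _
    rw [Matrix.single_apply]
    split_ifs <;> rfl
  rw [h, Matrix.single_apply]
  split_ifs
  · simp only [map_one, one_apply_eq_self, adjoint_bargmann_apply]
  · simp only [map_zero, zero_apply]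

/-! ### Transport of the generated algebras and the isomorphism -/

/-- An isometry on a complete space is a closed map, so taking images commutes with norm closure as
well as with algebraic generation. -/
theorem mem_cstarGenerated_image_iff {A B : Type*} [NormedRing A] [StarRing A] [NormedAlgebra ℂ A]
    [StarModule ℂ A] [ContinuousStar A] [CompleteSpace A] [NormedRing B] [StarRing B]
    [NormedAlgebra ℂ B] [StarModule ℂ B] [ContinuousStar B] {φ : A →⋆ₙₐ[ℂ] B} (hφ : Isometry φ)
    {s : Set A} {b : B} : b ∈ cstarGenerated (φ '' s) ↔ ∃ a ∈ cstarGenerated s, φ a = b := by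
  have h := NonUnitalStarSubalgebra.topologicalClosure_map
    (NonUnitalStarAlgebra.adjoin ℂ s) hφ.isClosedEmbedding.isClosedMap hφ.continuous
  rw [NonUnitalStarAlgHom.map_adjoin] at h
  rw [cstarGenerated, h]
  rfl

theorem mem_algT_iff {n : ℕ} {T : BergmanN n →L[ℂ] BergmanN n} :
    T ∈ algT n ↔ ∃ M ∈ algGamma n, bergmanRep n M = T := by
  let φ : MatrixFun n →⋆ₙₐ[ℂ] (BergmanN n →L[ℂ] BergmanN n) := bergmanRep n
  have hφ : Isometry φ := isometry_bergmanRep n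
  have him : φ '' insert (projGamma n) (range (projConst n)) =
      insert (projT n) (range (coordProj n)) := by
    rw [image_insert_eq, ← range_comp]
    exact congrArg₂ insert (bergmanRep_projGamma n)
      (congrArg range (funext (bergmanRep_projConst n)))
  rw [algT, ← him]
  exact mem_cstarGenerated_image_iff hφ

/-- The isomorphism `M ↦ R^* M R` of `D_n^{1,n}` onto `C^*(P_T; Q_{Π,(1)}, …, Q_{Π,(n)})`. -/
def algDEquiv {n : ℕ} (hn : 2 ≤ n) : algD n ≃⋆ₐ[ℂ] algT n where
  toEquiv := Equiv.ofBijective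
    (fun M => ⟨bergmanRep n M, mem_algT_iff.2 ⟨M, algGamma_eq_algD hn ▸ M.2, rfl⟩⟩) <| by
    constructor
    · intro M N h
      exact Subtype.ext (injective_bergmanRep n (congrArg Subtype.val h))
    · rintro ⟨T, hT⟩
      obtain ⟨M, hM, rfl⟩ := mem_algT_iff.1 hT
      rw [algGamma_eq_algD hn] at hM
      exact ⟨⟨M, hM⟩, rfl⟩
  map_mul' M N := Subtype.ext (map_mul (bergmanRep n) M.1 N.1)
  map_add' M N := Subtype.ext (map_add (bergmanRep n) M.1 N.1)
  map_star' M := Subtype.ext (map_star (bergmanRep n) M.1)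
  map_smul' c M := Subtype.ext (map_smul (bergmanRep n) c M.1)

theorem coe_algDEquiv {n : ℕ} (hn : 2 ≤ n) (M : algD n) :
    (algDEquiv hn M : BergmanN n →L[ℂ] BergmanN n) = bergmanRep n M := rfl

theorem isometry_algDEquiv {n : ℕ} (hn : 2 ≤ n) : Isometry (algDEquiv hn) :=
  fun M N => (isometry_bergmanRep n).edist_eq M.1 N.1

theorem bergmanRep_algDEquiv_symm {n : ℕ} (hn : 2 ≤ n) (S : algT n) :
    bergmanRep n ((algDEquiv hn).symm S : MatrixFun n) = S := by
  rw [← coe_algDEquiv hn, StarAlgEquiv.apply_symm_apply]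

end PolyBergman

end

theorem mainTheorem2 (n : ℕ) (hn : 2 ≤ n) :
    PolyBergman.algGamma n = (PolyBergman.algD n).toNonUnitalStarSubalgebra ∧
    ∃ Φ : PolyBergman.algT n ≃⋆ₐ[ℂ] PolyBergman.algD n,
      Isometry Φ ∧
      (∀ S : PolyBergman.algT n,
        PolyBergman.matrixMul (Φ S : PolyBergman.MatrixFun n) =
          PolyBergman.bargmannN n ∘L
            (S : PolyBergman.BergmanN n →L[ℂ] PolyBergman.BergmanN n) ∘L
              ContinuousLinearMap.adjoint (PolyBergman.bargmannN n)) ∧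
      (Φ ⟨PolyBergman.projT n, PolyBergman.projT_mem n⟩ : PolyBergman.MatrixFun n) =
        PolyBergman.projGamma n ∧
      ∀ j : Fin n,
        (Φ ⟨PolyBergman.coordProj n j, PolyBergman.coordProj_mem n j⟩ :
          PolyBergman.MatrixFun n) = PolyBergman.projConst n j := by
  refine ⟨PolyBergman.algGamma_eq_algD hn, (PolyBergman.algDEquiv hn).symm, ?_, fun S => ?_, ?_,
    fun j => ?_⟩
  · exact (PolyBergman.isometry_algDEquiv hn).right_inv
      (PolyBergman.algDEquiv hn).apply_symm_apply
  · rw [← PolyBergman.bargmannN_bergmanRep, PolyBergman.bergmanRep_algDEquiv_symm]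
  -- The inverse map is not given by a formula, so the values on generators are checked after
  -- applying the injective `bergmanRep`.
  · apply PolyBergman.injective_bergmanRep n
    rw [PolyBergman.bergmanRep_algDEquiv_symm, PolyBergman.bergmanRep_projGamma]
  · apply PolyBergman.injective_bergmanRep n
    rw [PolyBergman.bergmanRep_algDEquiv_symm, PolyBergman.bergmanRep_projConst]
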